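/- Let $Sp(2n,\mathbb R)=\{A: A^TJA=J\}$ with $J=\begin{pmatrix}0&-1\\1&0\end{pmatrix}$, and let $\mathcal S$ be its universal cover based at the identity: continuous paths $[0,1]\to Sp(2n,\mathbb R)$ starting at the identity, modulo homotopy with fixed end points, with the product induced by pointwise multiplication. Let $\mathcal C\subset\mathcal S$ be the cone of classes having a representative $X(t)$ with $\dot X(t)X(t)^{-1}=JH(t)$, where $H(t)$ is a continuous family of symmetric positive semidefinite matrices. For $f,g\in\mathcal S$ write $f\ge g$ if $fg^{-1}\in\mathcal C$. A dominant is an element $f\in\mathcal C\setminus\{1\}$ such that for every $g\in\mathcal S$ there is $m\in\mathbb N$ with $f^m\ge g$. For dominants $f,g$ put $$\gamma_k(f,g)=\inf\{p\in\mathbb Z:\ f^p\ge g^k\},\qquad \gamma(f,g)=\lim_{k\to\infty}\frac{\gamma_k(f,g)}{k}.$$ The Maslov quasimorphism $\mu:\mathcal S\to\mathbb R$ is $\mu([X])=\alpha(1)-\alpha(0)$, where $X(t)=U(t)P(t)$ is the polar decomposition ($U(t)\in U(n)\subset Sp(2n,\mathbb R)$ via $A+iB\mapsto\begin{pmatrix}A&-B\\B&A\end{pmatrix}$,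 and $P(t)$ symmetric positive definite) and $\alpha$ is continuous with $e^{2\pi i\alpha(t)}=\det U(t)$ (complex determinant); its homogenization is $\tilde\mu(x)=\lim_{k\to\infty}\mu(x^k)/k$. **Theorem.** For all dominants $X,Y\in\mathcal S$, the limits defining $\tilde\mu(X)$, $\tilde\mu(Y)$ and $\gamma(X,Y)$ exist, the infima defining $\gamma_k(X,Y)$ are taken over nonempty sets of integers bounded below, $\tilde\mu(X)\neq 0$, and $$\gamma(X,Y)=\frac{\tilde\mu(Y)}{\tilde\mu(X)}.$$ -/

import Mathlib

open scoped unitInterval Matrix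

namespace SympGrowth

open Matrix

/-! ### Relations defined by a cone in a group, dominants and relative growth -/

section Cone

variable {D : Type*} [Group D]

/-- The relation `f ≥ g` induced by a cone `C` in a group: `f * g⁻¹ ∈ C`. -/
def GeOf (C : Set D) (f g : D) : Prop := f * g⁻¹ ∈ C

/-- `f` is a dominant for the cone `C`: `f ∈ C`, `f ≠ 1`, and every `g` satisfies `f ^ m ≥ g` for
some natural number `m`. -/
def IsDominant (C : Set D) (f : D) : Prop :=
  f ∈ C ∧ f ≠ 1 ∧ ∀ g : D, ∃ m : ℕ, GeOf C (f ^ m) g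

/-- The set of integers `p` with `f ^ p ≥ g ^ k`. -/
def growthSet (C : Set D) (f g : D) (k : ℕ) : Set ℤ := {p : ℤ | GeOf C (f ^ p) (g ^ k)}

/-- `γ_k(f, g) = inf {p ∈ ℤ | f ^ p ≥ g ^ k}`. -/
noncomputable def growthAt (C : Set D) (f g : D) (k : ℕ) : ℤ := sInf (growthSet C f g k)

/-- The relative growth `γ(f, g) = lim_{k → ∞} γ_k(f, g) / k`. -/
noncomputable def relativeGrowth (C : Set D) (f g : D) : ℝ :=
  Filter.limUnder Filter.atTop fun k : ℕ => (growthAt C f g k : ℝ) / (k : ℝ)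

end Cone

/-! ### The universal cover of a topological group, as homotopy classes of based paths -/

section Cover

variable (G : Type*) [Group G] [TopologicalSpace G] [IsTopologicalGroup G]

/-- The group, under pointwise multiplication, of continuous paths `[0, 1] → G` that start at the
identity. -/
def basedPaths : Subgroup C(I, G) where
  carrier := {γ | γ 0 = 1}
  mul_mem' := by
    intro a b ha hb
    simp only [Set.mem_ofPred_eq] at ha hb ⊢
    simp [ha, hb]
  one_mem' := by simp
  inv_mem' := by
    intro a ha
    simp only [Set.mem_ofPred_eq] at ha ⊢
    simp [ha]

/-- Homotopy of based paths with fixed end points. It is compatible with pointwise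
multiplication. -/
def pathCon : Con (basedPaths G) where
  r γ δ := ContinuousMap.HomotopicRel (γ : C(I, G)) (δ : C(I, G)) {0, 1}
  iseqv := ⟨fun γ => ContinuousMap.HomotopicRel.refl _, fun h => h.symm, fun h h' => h.trans h'⟩
  mul' := by
    rintro w x y z ⟨F⟩ ⟨K⟩
    refine ⟨⟨⟨⟨fun p => F p * K p, by fun_prop⟩, fun t => ?_, fun t => ?_⟩, fun t s hs => ?_⟩⟩
    · simp
    · simp
    · have h1 := F.eq_fst t hs
      have h2 := K.eq_fst t hs
      simp only [ContinuousMap.coe_mk, Subgroup.coe_mul, ContinuousMap.mul_apply]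
      exact congrArg₂ (· * ·) h1 h2

/-- The universal cover of (the identity component of) `G` with base point the identity: paths
starting at the identity, up to homotopy with fixed end points. Its group structure is induced by
pointwise multiplication of paths. -/
abbrev Cover : Type _ := (pathCon G).Quotient

end Cover

/-! ### The symplectic group and its cone -/

/-- The symplectic group `Sp(2n, ℝ)`. -/
abbrev Sp (n : ℕ) : Type := Matrix.symplecticGroup (Fin n) ℝ

/-- Real matrices of size `2n`, in blocks of size `n`. -/
abbrev Mat (n : ℕ) : Type := Matrix (Fin n ⊕ Fin n) (Fin n ⊕ Fin n) ℝ

instance instTopGroupSp (n : ℕ) : IsTopologicalGroup (Sp n) where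
  continuous_mul := continuous_mul
  continuous_inv := by
    refine Continuous.subtype_mk (f := fun A : Sp n => (-J (Fin n) ℝ) * (A : Mat n)ᵀ * J (Fin n) ℝ)
      ?_ _
    fun_prop

/-- The universal cover `𝒮` of `Sp(2n, ℝ)`. -/
abbrev SpCover (n : ℕ) : Type := Cover (Sp n)

/-- The based path `X` solves `X'(t) = J H(t) X(t)` on `[0, 1]`, entry by entry; derivatives at
the end points are one-sided. Here `J = [[0, -1], [1, 0]]`. -/
def IsGeneratedBy {n : ℕ} (X : basedPaths (Sp n)) (H : ℝ → Mat n) : Prop :=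
  ∀ t ∈ Set.Icc (0 : ℝ) 1, ∀ i j,
    HasDerivWithinAt
      (fun s : ℝ => (((X : C(I, Sp n)) (Set.projIcc 0 1 zero_le_one s) : Sp n) : Mat n) i j)
      ((J (Fin n) ℝ * H t *
        (((X : C(I, Sp n)) (Set.projIcc 0 1 zero_le_one t) : Sp n) : Mat n)) i j)
      (Set.Icc 0 1) t

/-- The cone of `𝒮`: classes of paths generated by a continuous time-dependent Hamiltonian `H(t)`
which is a symmetric, positive semidefinite matrix for every `t`. -/
def nonnegCone (n : ℕ) : Set (SpCover n) :=
  {x | ∃ (X : basedPaths (Sp n)) (H : ℝ → Mat n), (X : SpCover n) = x ∧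
    ContinuousOn H (Set.Icc 0 1) ∧ (∀ t ∈ Set.Icc (0 : ℝ) 1, (H t).PosSemidef) ∧
    IsGeneratedBy X H}

/-! ### The Maslov quasimorphism -/

/-- The realization `A + iB ↦ [[A, -B], [B, A]]` of complex `n × n` matrices as real `2n × 2n`
matrices. -/
def realify {n : ℕ} (U : Matrix (Fin n) (Fin n) ℂ) : Mat n :=
  Matrix.fromBlocks (U.map Complex.re) (-U.map Complex.im) (U.map Complex.im) (U.map Complex.re)

/-- `α` is a continuous function with `e^{2πiα(t)} = det U(t)`, where `X(t) = U(t) P(t)` is the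
polar decomposition: `U(t)` unitary, `P(t)` symmetric and positive definite. -/
def IsPhase {n : ℕ} (X : basedPaths (Sp n)) (α : C(I, ℝ)) : Prop :=
  ∀ t : I, ∃ U ∈ Matrix.unitaryGroup (Fin n) ℂ, ∃ P : Mat n, P.PosDef ∧
    (((X : C(I, Sp n)) t : Sp n) : Mat n) = realify U * P ∧
    Complex.exp (2 * Real.pi * (α t) * Complex.I) = U.det

/-- (Auxiliary) twice the complex linear part of a real matrix. -/
def complexPart {n : ℕ} (A : Mat n) : Matrix (Fin n) (Fin n) ℂ :=
  (A.toBlocks₁₁ + A.toBlocks₂₂).map Complex.ofReal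
    + Complex.I • (A.toBlocks₂₁ - A.toBlocks₁₂).map Complex.ofReal

theorem complexPart_realify_mul {n : ℕ} (U : Matrix (Fin n) (Fin n) ℂ) (P : Mat n) :
    complexPart (realify U * P) = U * complexPart P := by
  obtain ⟨A, B, C, D, rfl⟩ : ∃ A B C D, P = fromBlocks A B C D :=
    ⟨_, _, _, _, (fromBlocks_toBlocks P).symm⟩
  ext i j
  simp only [complexPart, realify, fromBlocks_multiply, toBlocks_fromBlocks₁₁,
    toBlocks_fromBlocks₂₂, toBlocks_fromBlocks₂₁, toBlocks_fromBlocks₁₂, Matrix.add_apply,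
    Matrix.smul_apply, Matrix.map_apply, Matrix.mul_apply, Matrix.sub_apply, Matrix.neg_apply,
    smul_eq_mul]
  simp only [Complex.ofReal_add, Complex.ofReal_sub, Complex.ofReal_sum, Complex.ofReal_mul,
    Complex.ofReal_neg]
  simp only [← Finset.sum_add_distrib, ← Finset.sum_sub_distrib, Finset.mul_sum]
  refine Finset.sum_congr rfl fun k _ => ?_
  conv_rhs => rw [← Complex.re_add_im (U i k)]
  linear_combination (-((U i k).im : ℂ) * ((C k j : ℂ) - (B k j : ℂ))) * Complex.I_sq

theorem complexPart_realify {n : ℕ} (U : Matrix (Fin n) (Fin n) ℂ) :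
    complexPart (realify U) = (2 : ℂ) • U := by
  ext i j
  simp only [complexPart, realify, toBlocks_fromBlocks₁₁, toBlocks_fromBlocks₂₂,
    toBlocks_fromBlocks₂₁, toBlocks_fromBlocks₁₂, Matrix.add_apply, Matrix.smul_apply,
    Matrix.map_apply, Matrix.sub_apply, Matrix.neg_apply, smul_eq_mul]
  apply Complex.ext <;> simp <;> ring

theorem realify_one {n : ℕ} : realify (1 : Matrix (Fin n) (Fin n) ℂ) = 1 := by
  rw [← fromBlocks_one]
  simp only [realify]
  congr 1 <;> ext i j <;> by_cases h : i = j <;> simp [Matrix.one_apply, h]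

theorem complexPart_one {n : ℕ} : complexPart (1 : Mat n) = (2 : ℂ) • 1 := by
  rw [← complexPart_realify, realify_one]

theorem realify_conjTranspose {n : ℕ} (U : Matrix (Fin n) (Fin n) ℂ) :
    realify Uᴴ = (realify U)ᵀ := by
  simp only [realify, fromBlocks_transpose]
  congr 1 <;> ext i j <;> simp

section
open scoped MatrixOrder ComplexOrder

theorem complexPart_det_pos {n : ℕ} {P : Mat n} (hP : P.PosDef) :
    ∃ r : ℝ, 0 < r ∧ (complexPart P).det = r := by
  have key : (complexPart P).PosDef := by
    obtain ⟨B, hB⟩ := CStarAlgebra.nonneg_iff_eq_star_mul_self.mp hP.posSemidef.nonneg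
    have hBu : IsUnit B := by
      have h := hP.isUnit
      rw [Matrix.isUnit_iff_isUnit_det] at h ⊢
      rw [hB, Matrix.det_mul] at h
      exact isUnit_of_mul_isUnit_right h
    let V : Matrix (Fin n ⊕ Fin n) (Fin n) ℂ := Matrix.fromRows 1 (-Complex.I • 1)
    have hV : Function.Injective V.mulVec := by
      intro v w h
      have := congrArg (fun f => fun i => f (Sum.inl i)) h
      simpa [V, Matrix.fromRows_mulVec] using this
    have hBV : Function.Injective (B.map Complex.ofReal * V).mulVec := by
      have h2 : IsUnit (B.map Complex.ofReal) := hBu.map (Complex.ofRealHom.mapMatrix)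
      have h3 := Matrix.mulVec_injective_of_isUnit h2
      intro v w h
      simp only [← Matrix.mulVec_mulVec] at h
      exact hV (h3 h)
    have h4 := Matrix.PosDef.conjTranspose_mul_self _ hBV
    convert h4 using 1
    have h5 : (B.map Complex.ofReal)ᴴ * B.map Complex.ofReal = P.map Complex.ofReal := by
      rw [hB]
      ext i j
      simp [Matrix.mul_apply, Matrix.star_eq_conjTranspose]
    rw [Matrix.conjTranspose_mul, Matrix.mul_assoc, ← Matrix.mul_assoc _ _ V, h5]
    obtain ⟨A, B, C, D, rfl⟩ : ∃ A B C D, P = fromBlocks A B C D :=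
      ⟨_, _, _, _, (fromBlocks_toBlocks P).symm⟩
    have h6 : Vᴴ = Matrix.fromCols 1 (Complex.I • 1) := by
      ext i (j | j) <;> simp [V, Matrix.one_apply, eq_comm] <;> split_ifs <;> simp
    rw [h6]
    simp only [V, Matrix.fromBlocks_map, Matrix.fromBlocks_mul_fromRows,
      Matrix.fromCols_mul_fromRows]
    ext i j
    simp [complexPart]
    linear_combination (D i j : ℂ) * Complex.I_sq
  have h := key.det_pos
  rw [Complex.lt_def] at h
  refine ⟨(complexPart P).det.re, by simpa using h.1, ?_⟩
  apply Complex.ext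
  · simp
  · simpa using h.2.symm

/-- The polar decomposition of a symplectic matrix. -/
theorem exists_polar {n : ℕ} (A : Sp n) :
    ∃ U ∈ Matrix.unitaryGroup (Fin n) ℂ, ∃ P : Mat n, P.PosDef ∧ (A : Mat n) = realify U * P := by
  obtain ⟨A, hA⟩ := A
  have hA1 := SymplecticGroup.mem_iff'.mp hA
  set Jn : Mat n := J (Fin n) ℝ with hJ
  have hJt : Jnᵀ = -Jn := J_transpose _ _
  have hJJ : Jn * Jn = -1 := J_squared _ _
  have hJtJ : Jnᵀ * Jn = 1 := by rw [hJt, neg_mul, hJJ, neg_neg]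
  have hJJt : Jn * Jnᵀ = 1 := by rw [hJt, mul_neg, hJJ, neg_neg]
  have hAu : IsUnit A := by
    rw [Matrix.isUnit_iff_isUnit_det]; exact SymplecticGroup.symplectic_det hA
  set S : Mat n := Aᵀ * A with hS
  have hSpd : S.PosDef := by
    have := Matrix.PosDef.conjTranspose_mul_self A (Matrix.mulVec_injective_of_isUnit hAu)
    simpa [Matrix.conjTranspose_eq_transpose_of_trivial] using this
  have hSJS : Jnᵀ * S * Jn * S = 1 := by
    have h1 := SymplecticGroup.mem_iff.mp hA
    rw [← hJ] at h1
    calc Jnᵀ * S * Jn * S = Jnᵀ * (Aᵀ * (A * Jn * Aᵀ) * A) := by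
          rw [hS]; simp only [Matrix.mul_assoc]
      _ = 1 := by rw [h1, hA1, hJtJ]
  set P : Mat n := CFC.sqrt S with hP
  have hPP : P * P = S := CFC.sqrt_mul_sqrt_self S hSpd.posSemidef.nonneg
  have hP0 : P.PosSemidef := (CFC.sqrt_nonneg S).posSemidef
  have hPu : IsUnit P := by
    have h := hSpd.isUnit
    rw [Matrix.isUnit_iff_isUnit_det] at h ⊢
    rw [← hPP, Matrix.det_mul] at h
    exact isUnit_of_mul_isUnit_right h
  have hPpd : P.PosDef := hP0.posDef_iff_isUnit.mpr hPu
  have hPt : Pᵀ = P := by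
    have := hP0.isHermitian
    rwa [Matrix.IsHermitian, Matrix.conjTranspose_eq_transpose_of_trivial] at this
  set Q : Mat n := Jnᵀ * P * Jn with hQ
  have hQ0 : Q.PosSemidef := by
    have := hP0.conjTranspose_mul_mul_same Jn
    rwa [Matrix.conjTranspose_eq_transpose_of_trivial] at this
  have hQt : Qᵀ = Q := by
    have := hQ0.isHermitian
    rwa [Matrix.IsHermitian, Matrix.conjTranspose_eq_transpose_of_trivial] at this
  have hQQ : Q * Q = S⁻¹ := by
    have h1 : Q * Q = Jnᵀ * S * Jn := by
      calc Q * Q = Jnᵀ * P * (Jn * Jnᵀ) * P * Jn := by rw [hQ]; simp only [Matrix.mul_assoc]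
        _ = Jnᵀ * S * Jn := by rw [hJJt, Matrix.mul_one, Matrix.mul_assoc Jnᵀ, hPP]
    rw [h1]
    exact (Matrix.inv_eq_left_inv hSJS).symm
  have hQP : Q = P⁻¹ := by
    rw [hP, hSpd.posSemidef.inv_sqrt]
    exact (CFC.sqrt_unique hQQ hQ0.nonneg).symm
  have hPd : IsUnit P.det := (Matrix.isUnit_iff_isUnit_det P).mp hPu
  have hQP1 : Q * P = 1 := by rw [hQP]; exact Matrix.nonsing_inv_mul _ hPd
  have hPQ1 : P * Q = 1 := by rw [hQP]; exact Matrix.mul_nonsing_inv _ hPd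
  have hPJP : P * Jn * P = Jn := by
    calc P * Jn * P = Jn * (Q * P) := by
          rw [hQ]
          simp only [← Matrix.mul_assoc]
          rw [hJJt, Matrix.one_mul]
      _ = Jn := by rw [hQP1, Matrix.mul_one]
  have hQJQ : Q * Jn * Q = Jn := by
    calc Q * Jn * Q = Q * (P * Jn * P) * Q := by rw [hPJP]
      _ = (Q * P) * Jn * (P * Q) := by simp only [Matrix.mul_assoc]
      _ = Jn := by rw [hQP1, hPQ1, Matrix.one_mul, Matrix.mul_one]
  set W : Mat n := A * Q with hW
  have hWP : W * P = A := by rw [hW, Matrix.mul_assoc, hQP1, Matrix.mul_one]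
  have hWW : Wᵀ * W = 1 := by
    calc Wᵀ * W = Q * (Aᵀ * A) * Q := by
          rw [hW, Matrix.transpose_mul, hQt]; simp only [Matrix.mul_assoc]
      _ = (Q * P) * (P * Q) := by rw [← hS, ← hPP]; simp only [Matrix.mul_assoc]
      _ = 1 := by rw [hQP1, hPQ1, Matrix.one_mul]
  have hWW' : W * Wᵀ = 1 := mul_eq_one_comm.mp hWW
  have hWJW : Wᵀ * Jn * W = Jn := by
    calc Wᵀ * Jn * W = Q * (Aᵀ * Jn * A) * Q := by
          rw [hW, Matrix.transpose_mul, hQt]; simp only [Matrix.mul_assoc]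
      _ = Jn := by rw [hA1, hQJQ]
  have hJW : Jn * W = W * Jn := by
    calc Jn * W = (W * Wᵀ) * (Jn * W) := by rw [hWW', Matrix.one_mul]
      _ = W * (Wᵀ * Jn * W) := by simp only [Matrix.mul_assoc]
      _ = W * Jn := by rw [hWJW]
  obtain ⟨a, b, c, d, habcd⟩ : ∃ a b c d, W = fromBlocks a b c d :=
    ⟨_, _, _, _, (fromBlocks_toBlocks W).symm⟩
  have hb : b = -c ∧ d = a := by
    rw [habcd, hJ, Matrix.J, fromBlocks_multiply, fromBlocks_multiply, fromBlocks_inj] at hJW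
    obtain ⟨h1, h2, -, -⟩ := hJW
    simp at h1 h2
    exact ⟨h1.symm, h2⟩
  obtain ⟨rfl, rfl⟩ := hb
  set U : Matrix (Fin n) (Fin n) ℂ := Matrix.of fun i j => ⟨d i j, c i j⟩ with hU
  have hUW : realify U = W := by
    rw [habcd, realify]
    congr 1
  refine ⟨U, ?_, P, hPpd, by rw [hUW, hWP]⟩
  rw [Matrix.mem_unitaryGroup_iff', Matrix.star_eq_conjTranspose]
  have h1 := complexPart_realify_mul Uᴴ (realify U)
  rw [realify_conjTranspose, hUW, hWW, complexPart_one, ← hUW, complexPart_realify,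
    Matrix.mul_smul] at h1
  exact (smul_right_injective _ (two_ne_zero (α := ℂ)) h1).symm

end

/-- (Auxiliary) the determinant of the unitary part, as a function of the matrix. -/
theorem exists_unitDet (n : ℕ) : ∃ c : C(Sp n, Circle),
    ∀ (A : Sp n), ∀ U ∈ Matrix.unitaryGroup (Fin n) ℂ, ∀ P : Mat n, P.PosDef →
      (A : Mat n) = realify U * P → (c A : ℂ) = U.det := by
  have hdet : ∀ (A : Mat n), ∀ U ∈ Matrix.unitaryGroup (Fin n) ℂ, ∀ P : Mat n, P.PosDef →
      A = realify U * P → ∃ r : ℝ, 0 < r ∧ (complexPart A).det = U.det * r := by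
    rintro A U - P hP rfl
    obtain ⟨r, hr, h⟩ := complexPart_det_pos hP
    exact ⟨r, hr, by rw [complexPart_realify_mul, Matrix.det_mul, h]⟩
  have hU1 : ∀ U ∈ Matrix.unitaryGroup (Fin n) ℂ, ‖U.det‖ = 1 := by
    intro U hU
    exact CStarRing.norm_of_mem_unitary (Matrix.det_of_mem_unitary hU)
  have hne : ∀ A : Sp n, (complexPart (A : Mat n)).det ≠ 0 := by
    intro A
    obtain ⟨U, hU, P, hP, h⟩ := exists_polar A
    obtain ⟨r, hr, h2⟩ := hdet _ U hU P hP h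
    rw [h2]
    refine mul_ne_zero (fun h0 => ?_) (by exact_mod_cast hr.ne')
    have := hU1 U hU
    rw [h0] at this
    simp at this
  have hcont : Continuous fun A : Sp n => (complexPart (A : Mat n)).det := by
    refine Continuous.matrix_det ?_
    refine continuous_matrix fun i j => ?_
    have hent : ∀ k l, Continuous fun A : Sp n => (A : Mat n) k l := fun k l =>
      continuous_subtype_val.matrix_elem k l
    simp only [complexPart, Matrix.add_apply, Matrix.smul_apply, Matrix.map_apply,
      Matrix.sub_apply, toBlocks₁₁, toBlocks₂₂, toBlocks₂₁, toBlocks₁₂, Matrix.of_apply]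
    have h1 := hent (Sum.inl i) (Sum.inl j)
    have h2 := hent (Sum.inr i) (Sum.inr j)
    have h3 := hent (Sum.inr i) (Sum.inl j)
    have h4 := hent (Sum.inl i) (Sum.inr j)
    exact (Complex.continuous_ofReal.comp (h1.add h2)).add
      ((Complex.continuous_ofReal.comp (h3.sub h4)).const_smul Complex.I)
  refine ⟨⟨fun A => ⟨(complexPart (A : Mat n)).det / ‖(complexPart (A : Mat n)).det‖, ?_⟩, ?_⟩, ?_⟩
  · rw [Submonoid.unitSphere, Submonoid.mem_mk, Subsemigroup.mem_mk, mem_sphere_zero_iff_norm,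
      norm_div, Complex.norm_real, norm_norm,
      div_self (norm_ne_zero_iff.mpr (hne A))]
  · refine Continuous.subtype_mk ?_ _
    exact hcont.div (by fun_prop) fun A => by
      exact_mod_cast norm_ne_zero_iff.mpr (hne A)
  · intro A U hU P hP h
    obtain ⟨r, hr, h2⟩ := hdet _ U hU P hP h
    change (complexPart (A : Mat n)).det / ‖(complexPart (A : Mat n)).det‖ = U.det
    rw [h2, norm_mul, hU1 U hU, Complex.norm_real, Real.norm_of_nonneg hr.le, one_mul,
      mul_div_assoc, div_self (by exact_mod_cast hr.ne'), mul_one]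

theorem exists_isPhase {n : ℕ} (X : basedPaths (Sp n)) : ∃ α : C(I, ℝ), IsPhase X α := by
  obtain ⟨c, hc⟩ := exists_unitDet n
  obtain ⟨e, he⟩ := Circle.exp_surjective (c ((X : C(I, Sp n)) 0))
  obtain ⟨Γ, hΓ, -⟩ := Circle.isCoveringMap_exp.exists_path_lifts (c.comp (X : C(I, Sp n))) e
    (by simp [he])
  refine ⟨⟨fun t => Γ t / (2 * Real.pi), by fun_prop⟩, fun t => ?_⟩
  obtain ⟨U, hU, P, hP, h⟩ := exists_polar ((X : C(I, Sp n)) t)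
  refine ⟨U, hU, P, hP, h, ?_⟩
  rw [← hc _ U hU P hP h]
  have h2 := congrArg (fun z : Circle => (z : ℂ)) (congrFun hΓ t)
  simp only [Function.comp_apply, ContinuousMap.comp_apply, Circle.coe_exp] at h2
  rw [← h2]
  congr 2
  have : (2 * Real.pi : ℂ) ≠ 0 := by simp [Real.pi_ne_zero]
  simp only [ContinuousMap.coe_mk]
  push_cast
  field_simp

theorem isPhase_homotopic {n : ℕ} {X Y : basedPaths (Sp n)} {α β : C(I, ℝ)}
    (hα : IsPhase X α) (hβ : IsPhase Y β) (h : pathCon (Sp n) X Y) :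
    α 1 - α 0 = β 1 - β 0 := by
  obtain ⟨c, hc⟩ := exists_unitDet n
  have hphase : ∀ {X : basedPaths (Sp n)} {α : C(I, ℝ)}, IsPhase X α → ∀ t,
      Circle.exp (2 * Real.pi * α t) = c ((X : C(I, Sp n)) t) := by
    intro X α hα t
    obtain ⟨U, hU, P, hP, h1, h2⟩ := hα t
    apply Circle.coe_injective
    rw [hc _ U hU P hP h1, ← h2, Circle.coe_exp]
    push_cast
    ring_nf
  have hc1 : c 1 = 1 := by
    apply Circle.coe_injective
    rw [hc 1 1 (one_mem _) 1 Matrix.PosDef.one]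
    · simp
    · rw [Matrix.mul_one, realify_one]
      rfl
  have hlift : ∀ {X : basedPaths (Sp n)} {α : C(I, ℝ)} (_ : IsPhase X α)
      (h0 : c.comp (X : C(I, Sp n)) 0 = Circle.exp 0),
      2 * Real.pi * (α 1 - α 0) =
        Circle.isCoveringMap_exp.liftPath (c.comp (X : C(I, Sp n))) 0 h0 1 := by
    intro X α hα h0
    have h00 : Circle.exp (2 * Real.pi * α 0) = 1 := by
      rw [hphase hα 0]; simpa using h0
    have key := (Circle.isCoveringMap_exp.eq_liftPath_iff' (γ := c.comp (X : C(I, Sp n)))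
      (e := 0) h0 (Γ := ⟨fun t => 2 * Real.pi * α t - 2 * Real.pi * α 0, by fun_prop⟩)).mpr
      ⟨by
        funext t
        simp only [Function.comp_apply, ContinuousMap.coe_mk, Circle.exp_sub, h00, div_one,
          ContinuousMap.comp_apply]
        exact hphase hα t, by simp⟩
    rw [← key]
    simp only [ContinuousMap.coe_mk]
    ring
  have hX0 : (X : C(I, Sp n)) 0 = 1 := X.2
  have hY0 : (Y : C(I, Sp n)) 0 = 1 := Y.2
  have h0X : c.comp (X : C(I, Sp n)) 0 = Circle.exp 0 := by simp [hX0, hc1]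
  have h0Y : c.comp (Y : C(I, Sp n)) 0 = Circle.exp 0 := by simp [hY0, hc1]
  have hXY : ContinuousMap.HomotopicRel (X : C(I, Sp n)) (Y : C(I, Sp n)) {0, 1} := h
  have h1 := Circle.isCoveringMap_exp.liftPath_apply_one_eq_of_homotopicRel
    (hXY.comp_continuousMap c) 0 h0X h0Y
  rw [← hlift hα h0X, ← hlift hβ h0Y] at h1
  exact mul_left_cancel₀ (by positivity) h1

/-- The Maslov quasimorphism: `μ([X]) = α(1) - α(0)`, where `e^{2πiα(t)} = det U(t)` and
`X(t) = U(t) P(t)` is the polar decomposition. -/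
noncomputable def maslov {n : ℕ} (x : SpCover n) : ℝ :=
  Con.liftOn x (fun X => (exists_isPhase X).choose 1 - (exists_isPhase X).choose 0)
    fun X Y h => isPhase_homotopic (exists_isPhase X).choose_spec (exists_isPhase Y).choose_spec h

theorem maslov_coe {n : ℕ} {X : basedPaths (Sp n)} {α : C(I, ℝ)} (h : IsPhase X α) :
    maslov (X : SpCover n) = α 1 - α 0 :=
  isPhase_homotopic (exists_isPhase X).choose_spec h ((pathCon (Sp n)).refl X)

/-- The homogeneous Maslov quasimorphism `μ̃(x) = lim_{k → ∞} μ(x ^ k) / k`. -/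
noncomputable def homMaslov {n : ℕ} (x : SpCover n) : ℝ :=
  Filter.limUnder Filter.atTop fun k : ℕ => maslov (x ^ k) / (k : ℝ)

end SympGrowth

/-!
The quasimorphism `maslov` detects the cone up to a bounded error: it is nonnegative on the cone,
and every class on which it is large enough belongs to the cone. Hence `f ^ p ≥ g ^ k` holds if
`p * μ̃ f - k * μ̃ g` exceeds some constant, and fails if it is below another constant, so that
`γ_k(f, g) = k * μ̃ g / μ̃ f + O(1)` (`relativeGrowth_eq_of_quasimorphism`).

Both facts, and the quasimorphism property itself, come from a coarse normal form
(`exists_isBetween_and_abs_maslov_sub_le`). Let `z` be the class of the full rotation `e^{2πit}`,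
which is central and lies in the cone. Every class `f` is `z ^ q` times a factor between
`z ^ (-K)` and `z ^ K`, with `K` independent of `f`, and `maslov f = n * q + O(1)`. Nonnegativity of
`maslov` on the cone pins down `q` up to a bounded error, so `q` and `maslov` are quasimorphisms
(`exists_defect_of_isBetween`).

The normal form is obtained from the polar decomposition of a path, `X = V R²` with `V` unitary and
`R` positive definite and symplectic.
* If `j` is the class of the quarter turn, then `j r j⁻¹ = r⁻¹` for the class `r` of `R`, because
  `J` conjugates every positive definite symplectic matrix to its inverse. So `r² j = r j r⁻¹` is
  conjugate to `j` and lies in the cone; the same holds for `r⁻¹`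
  (`sq_mul_quarter_mem_nonnegCone`).
* The unitary factor `V` is homotopic to a loop of diagonal matrices followed by a path
  `exp (i t L)` with `‖L‖ ≤ 2π` (`exists_unitary_normal_form`). Locally along `V` a logarithm `L` can
  be chosen continuously, by cutting the circle at a point outside the spectrum; two such
  logarithms of the same matrix commute, and their difference generates a loop which the spectral
  theorem makes diagonal. In the cover a diagonal loop is central, and it depends only on the
  total winding number, since permuting the coordinates is a conjugation.

Nonnegativity on the cone (`maslov_nonneg`) is a computation with Jacobi's formula: the phase is
the argument of `det C`, where `C` is the complex linear part of `X`, and for `X' = J H X` the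
imaginary part of its logarithmic derivative is `tr (H X C⁻¹)`; here `X C⁻¹` is positive semidefinite
as `X` is symplectic (`posSemidef_mul_realify`).
-/

namespace SympGrowth

open Filter Topology

/-! ### Quasimorphisms and relative growth in groups with a cone -/

section Quasimorphism

variable {D : Type*} [Group D]

theorem abs_map_one_le_of_quasimorphism {μ : D → ℝ} {B : ℝ}
    (hμ : ∀ f g, |μ (f * g) - μ f - μ g| ≤ B) : |μ 1| ≤ B := by
  have h := hμ 1 1
  rw [mul_one, sub_self, zero_sub, abs_neg] at h
  exact h

/-- Fekete's lemma for the subadditive sequence `μ (x ^ k) + B`. -/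
theorem exists_tendsto_and_mul_le_of_quasimorphism {μ : D → ℝ} {B : ℝ}
    (hμ : ∀ f g, |μ (f * g) - μ f - μ g| ≤ B) (x : D) :
    ∃ L : ℝ, Tendsto (fun k : ℕ => μ (x ^ k) / (k : ℝ)) atTop (𝓝 L) ∧
      ∀ k : ℕ, k * L ≤ μ (x ^ k) + B := by
  have h1 := abs_le.mp (abs_map_one_le_of_quasimorphism hμ)
  have hsub : Subadditive fun k : ℕ => μ (x ^ k) + B := fun m k => by
    have := (abs_le.mp (hμ (x ^ m) (x ^ k))).2
    simp only [pow_add]; linarith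
  have hsup : Subadditive fun k : ℕ => B - μ (x ^ k) := fun m k => by
    have := (abs_le.mp (hμ (x ^ m) (x ^ k))).1
    simp only [pow_add]; linarith
  have hbdd : BddBelow (Set.range fun k : ℕ => (μ (x ^ k) + B) / (k : ℝ)) := by
    refine ⟨min 0 (μ x - B), ?_⟩
    rintro _ ⟨k, rfl⟩
    rcases Nat.eq_zero_or_pos k with rfl | hk
    · simp
    refine (min_le_right _ _).trans ?_
    have h2 := hsup.apply_mul_add_le k 1 0
    simp only [mul_one, add_zero, pow_one, pow_zero] at h2
    rw [le_div_iff₀ (by exact_mod_cast hk)]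
    linarith
  refine ⟨hsub.lim, ?_, fun k => ?_⟩
  · have h2 := (hsub.tendsto_lim hbdd).sub (tendsto_const_div_atTop_nhds_zero_nat B)
    simpa [add_div] using h2
  · rcases Nat.eq_zero_or_pos k with rfl | hk
    · simp only [Nat.cast_zero, zero_mul, pow_zero]; linarith
    · have h2 := hsub.lim_le_div hbdd hk.ne'
      rw [le_div_iff₀ (by exact_mod_cast hk)] at h2
      linarith

/-- The homogenization of a quasimorphism exists, and stays within the defect of it. -/
theorem exists_homogenization {μ : D → ℝ} {B : ℝ}
    (hμ : ∀ f g, |μ (f * g) - μ f - μ g| ≤ B) (x : D) :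
    ∃ L : ℝ, Tendsto (fun k : ℕ => μ (x ^ k) / (k : ℝ)) atTop (𝓝 L) ∧
      ∀ k : ℕ, |μ (x ^ k) - k * L| ≤ B := by
  obtain ⟨L, hL, hle⟩ := exists_tendsto_and_mul_le_of_quasimorphism hμ x
  obtain ⟨L', hL', hle'⟩ := exists_tendsto_and_mul_le_of_quasimorphism (μ := fun f => -μ f)
    (B := B) (fun f g => by rw [← abs_neg]; convert hμ f g using 2; ring) x
  have h2 : L' = -L := tendsto_nhds_unique hL' (by simpa [neg_div] using hL.neg)
  refine ⟨L, hL, fun k => abs_le.mpr ⟨?_, ?_⟩⟩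
  · linarith [hle k]
  · have := hle' k
    rw [h2] at this
    linarith

theorem abs_zpow_sub_le_of_quasimorphism {μ : D → ℝ} {B : ℝ}
    (hμ : ∀ f g, |μ (f * g) - μ f - μ g| ≤ B) {x : D} {L : ℝ}
    (hL : ∀ k : ℕ, |μ (x ^ k) - k * L| ≤ B) (p : ℤ) : |μ (x ^ p) - p * L| ≤ 3 * B := by
  have h1 := abs_le.mp (abs_map_one_le_of_quasimorphism hμ)
  obtain ⟨k, rfl | rfl⟩ := p.eq_nat_or_neg
  · have h2 := abs_le.mp (hL k)
    rw [zpow_natCast, Int.cast_natCast, abs_le]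
    constructor <;> linarith
  · have h2 := abs_le.mp (hL k)
    have h3 := abs_le.mp (hμ (x ^ k) (x ^ (-(k : ℤ))))
    rw [zpow_neg, zpow_natCast, mul_inv_cancel] at h3
    rw [zpow_neg, zpow_natCast, Int.cast_neg, Int.cast_natCast, abs_le]
    constructor <;> linarith

/-- If a quasimorphism is nonnegative on a cone, and the cone contains every element on which the
quasimorphism is large, then relative growth is the quotient of the homogenizations: the condition
`f ^ p ≥ g ^ k` amounts, up to a bounded error, to `p * μ̃ f ≥ k * μ̃ g`. -/
theorem relativeGrowth_eq_of_quasimorphism {C : Set D} {μ : D → ℝ} {B E : ℝ}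
    (hμ : ∀ f g, |μ (f * g) - μ f - μ g| ≤ B) (hpos : ∀ f ∈ C, 0 ≤ μ f)
    (hlarge : ∀ f, E ≤ μ f → f ∈ C) (hunb : ∀ R : ℝ, ∃ g, R ≤ μ g) {f g : D}
    (hf : IsDominant C f) {a b : ℝ}
    (ha : Tendsto (fun k : ℕ => μ (f ^ k) / (k : ℝ)) atTop (𝓝 a))
    (hb : Tendsto (fun k : ℕ => μ (g ^ k) / (k : ℝ)) atTop (𝓝 b)) :
    a ≠ 0 ∧ (∀ k : ℕ, (growthSet C f g k).Nonempty ∧ BddBelow (growthSet C f g k)) ∧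
    Tendsto (fun k : ℕ => (growthAt C f g k : ℝ) / (k : ℝ)) atTop (𝓝 (b / a)) := by
  have hab : ∀ {x : D} {c : ℝ}, Tendsto (fun k : ℕ => μ (x ^ k) / (k : ℝ)) atTop (𝓝 c) →
      ∀ k : ℕ, |μ (x ^ k) - k * c| ≤ B := by
    intro x c hc
    obtain ⟨L, hL, hk⟩ := exists_homogenization hμ x
    rwa [tendsto_nhds_unique hc hL]
  have hf' := abs_zpow_sub_le_of_quasimorphism hμ (hab ha)
  have hg' := abs_zpow_sub_le_of_quasimorphism hμ (hab hb)
  -- a dominant exceeds elements with arbitrarily large value of the quasimorphism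
  have ha0 : 0 < a := by
    obtain ⟨g, hg⟩ := hunb (2 * B + 1)
    obtain ⟨m, hm⟩ := hf.2.2 g
    have h1 := hpos _ hm
    have h2 := abs_le.mp (hμ (f ^ m * g⁻¹) g)
    rw [inv_mul_cancel_right] at h2
    have h3 := abs_le.mp (hab ha m)
    by_contra! h
    have : (m : ℝ) * a ≤ 0 := mul_nonpos_of_nonneg_of_nonpos (Nat.cast_nonneg m) h
    linarith
  have hB : 0 ≤ B := (abs_nonneg _).trans (hμ 1 1)
  have key : ∀ (p : ℤ) (k : ℕ), |μ (f ^ p * (g ^ k)⁻¹) - (p * a - k * b)| ≤ 7 * B := by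
    intro p k
    have h1 := abs_le.mp (hf' p)
    have h2 := abs_le.mp (hg' (-k))
    have h3 := abs_le.mp (hμ (f ^ p) (g ^ (-(k : ℤ))))
    rw [zpow_neg, zpow_natCast] at h2 h3
    push_cast at h2
    rw [abs_le]
    constructor <;> linarith
  have hmem : ∀ (p : ℤ) (k : ℕ), (k * b + (E + 7 * B)) / a ≤ p → p ∈ growthSet C f g k := by
    intro p k h
    rw [div_le_iff₀ ha0] at h
    have := abs_le.mp (key p k)
    exact hlarge _ (by linarith)
  have hge : ∀ (p : ℤ) (k : ℕ), p ∈ growthSet C f g k → (k * b - 7 * B) / a ≤ p := by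
    intro p k h
    rw [div_le_iff₀ ha0]
    have := abs_le.mp (key p k)
    have := hpos _ h
    linarith
  have hne : ∀ k : ℕ, (growthSet C f g k).Nonempty := fun k => ⟨_, hmem _ k (Int.le_ceil _)⟩
  have hbd : ∀ k : ℕ, BddBelow (growthSet C f g k) := fun k =>
    ⟨⌊(k * b - 7 * B) / a⌋, fun p hp => by
      exact_mod_cast (Int.floor_le _).trans (hge p k hp)⟩
  refine ⟨ha0.ne', fun k => ⟨hne k, hbd k⟩, ?_⟩
  have hup : ∀ k : ℕ, (growthAt C f g k : ℝ) ≤ (k * b + (E + 7 * B)) / a + 1 := fun k => by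
    refine le_trans ?_ (Int.ceil_lt_add_one ((k * b + (E + 7 * B)) / a)).le
    exact_mod_cast csInf_le (hbd k) (hmem _ k (Int.le_ceil _))
  have hlo : ∀ k : ℕ, (k * b - 7 * B) / a ≤ growthAt C f g k := fun k =>
    hge _ k (Int.csInf_mem (hne k) (hbd k))
  have hlim : ∀ c : ℝ, Tendsto (fun k : ℕ => b / a + c / (k : ℝ)) atTop (𝓝 (b / a)) := fun c => by
    simpa using (tendsto_const_nhds (x := b / a)).add (tendsto_const_div_atTop_nhds_zero_nat c)
  refine tendsto_of_tendsto_of_tendsto_of_le_of_le' (hlim (-(7 * B) / a))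
    (hlim ((E + 7 * B) / a + 1)) ?_ ?_
  · filter_upwards [eventually_gt_atTop 0] with k hk
    have hk' : (0 : ℝ) < k := by exact_mod_cast hk
    rw [le_div_iff₀ hk']
    refine le_trans (le_of_eq ?_) (hlo k)
    field_simp
    ring
  · filter_upwards [eventually_gt_atTop 0] with k hk
    have hk' : (0 : ℝ) < k := by exact_mod_cast hk
    rw [div_le_iff₀ hk']
    refine (hup k).trans (le_of_eq ?_)
    field_simp
    ring

end Quasimorphism

section CentralElement

variable {D : Type*} [Group D]

/-- `f` lies between `z ^ (-K)` and `z ^ K` for the relation given by the cone `C`. -/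
def IsBetween (C : Set D) (z : D) (K : ℕ) (f : D) : Prop := z ^ K * f ∈ C ∧ z ^ K * f⁻¹ ∈ C

variable {C : Set D} {z : D}

theorem IsBetween.inv {K : ℕ} {f : D} (h : IsBetween C z K f) : IsBetween C z K f⁻¹ :=
  ⟨h.2, by rw [inv_inv]; exact h.1⟩

theorem IsBetween.mul (hC : ∀ f ∈ C, ∀ g ∈ C, f * g ∈ C) (hz : ∀ f, Commute z f) {K L : ℕ}
    {f g : D} (hf : IsBetween C z K f) (hg : IsBetween C z L g) :
    IsBetween C z (K + L) (f * g) := by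
  have key : ∀ {K L : ℕ} {f g : D}, z ^ K * f ∈ C → z ^ L * g ∈ C → z ^ (K + L) * (f * g) ∈ C := by
    intro K L f g h1 h2
    convert hC _ h1 _ h2 using 1
    rw [pow_add, mul_assoc, mul_assoc, ((hz f).pow_left L).left_comm]
  refine ⟨key hf.1 hg.1, ?_⟩
  rw [mul_inv_rev, add_comm]
  exact key hg.2 hf.2

theorem zpow_mem_cone (hC : ∀ f ∈ C, ∀ g ∈ C, f * g ∈ C) (h1 : 1 ∈ C) (hzC : z ∈ C) {m : ℤ}
    (hm : 0 ≤ m) : z ^ m ∈ C := by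
  lift m to ℕ using hm
  rw [zpow_natCast]
  induction m with
  | zero => simpa using h1
  | succ m ih => rw [pow_succ]; exact hC _ ih _ hzC

theorem mem_cone_of_isBetween (hC : ∀ f ∈ C, ∀ g ∈ C, f * g ∈ C) (h1 : 1 ∈ C) (hzC : z ∈ C)
    {K : ℕ} {q : ℤ} {f : D} (hq : K ≤ q) (h : IsBetween C z K (z ^ (-q) * f)) : f ∈ C := by
  convert hC _ (zpow_mem_cone hC h1 hzC (sub_nonneg.mpr hq)) _ h.1 using 1
  rw [← mul_assoc, ← mul_assoc, ← zpow_natCast, ← zpow_add, ← zpow_add]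
  simp

/-- If every `f` is a power `z ^ q` of a central element of the cone up to a bounded factor, and `μ`
is `N * q` up to a bounded error, then `μ` is a quasimorphism: the exponent `q` is determined
up to a bounded error, because `μ` is nonnegative on the cone. -/
theorem exists_defect_of_isBetween {μ : D → ℝ} {N c : ℝ} {K : ℕ} (hN : 0 < N)
    (hC : ∀ f ∈ C, ∀ g ∈ C, f * g ∈ C) (hz : ∀ f, Commute z f)
    (hpos : ∀ f ∈ C, 0 ≤ μ f) (hμz : ∀ q : ℤ, μ (z ^ q) = N * q)
    (hnf : ∀ f, ∃ q : ℤ, IsBetween C z K (z ^ (-q) * f) ∧ |μ f - N * q| ≤ c) (f g : D) :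
    |μ (f * g) - μ f - μ g| ≤ N * (3 * K) + 3 * c := by
  obtain ⟨p, hp, hp'⟩ := hnf f
  obtain ⟨q, hq, hq'⟩ := hnf g
  obtain ⟨r, hr, hr'⟩ := hnf (f * g)
  have h1 : IsBetween C z (K + K + K) (z ^ (r - p - q)) := by
    convert (hp.mul hC hz hq).mul hC hz hr.inv using 1
    have hc : ∀ m : ℤ, z ^ m * f = f * z ^ m := fun m => ((hz f).zpow_left m).eq
    have e1 : z ^ (-p) * f * (z ^ (-q) * g) = z ^ (-p - q) * (f * g) := by
      rw [mul_assoc, ← mul_assoc f, ← hc, sub_eq_add_neg, zpow_add]; simp only [mul_assoc]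
    have e2 : (z ^ (-r) * (f * g))⁻¹ = (f * g)⁻¹ * z ^ r := by
      rw [mul_inv_rev, zpow_neg, inv_inv]
    rw [e1, e2, ← mul_assoc, mul_inv_cancel_right, ← zpow_add]
    congr 1; ring
  have h2 := hpos _ h1.1
  have h3 := hpos _ h1.2
  rw [← zpow_natCast, ← zpow_add, hμz, mul_nonneg_iff_of_pos_left hN] at h2
  rw [← zpow_natCast, ← zpow_neg, ← zpow_add, hμz, mul_nonneg_iff_of_pos_left hN] at h3
  push_cast at h2 h3
  have h4 : N * (r - p - q) ≤ N * (3 * K) := mul_le_mul_of_nonneg_left (by linarith) hN.le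
  have h5 : N * -(3 * K) ≤ N * (r - p - q) := mul_le_mul_of_nonneg_left (by linarith) hN.le
  rw [abs_le] at *
  constructor <;> linarith

theorem mem_cone_of_le {μ : D → ℝ} {N c : ℝ} {K : ℕ} (hN : 0 < N)
    (hC : ∀ f ∈ C, ∀ g ∈ C, f * g ∈ C) (h1 : 1 ∈ C) (hzC : z ∈ C)
    (hnf : ∀ f, ∃ q : ℤ, IsBetween C z K (z ^ (-q) * f) ∧ |μ f - N * q| ≤ c) {f : D}
    (hf : N * K + c ≤ μ f) : f ∈ C := by
  obtain ⟨q, hq, hq'⟩ := hnf f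
  refine mem_cone_of_isBetween hC h1 hzC ?_ hq
  have h2 : N * K ≤ N * q := by linarith [(abs_le.mp hq').2]
  exact_mod_cast le_of_mul_le_mul_left h2 hN

end CentralElement

/-! ### Classes of paths in the universal cover of a topological group -/

section CoverLemmas

variable {G : Type*} [Group G] [TopologicalSpace G] [IsTopologicalGroup G]

theorem basedPaths_apply_zero (X : basedPaths G) : (X : C(I, G)) 0 = 1 := X.2

theorem coe_inv_path (X : basedPaths G) : ((X⁻¹ : basedPaths G) : Cover G) = (X : Cover G)⁻¹ := rfl

theorem coe_eq_of_homotopy {X Y : basedPaths G} (F : I × I → G) (hF : Continuous F)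
    (h0 : ∀ t, F (0, t) = (X : C(I, G)) t) (h1 : ∀ t, F (1, t) = (Y : C(I, G)) t)
    (hl : ∀ s, F (s, 0) = 1) (hr : ∀ s, F (s, 1) = (X : C(I, G)) 1) :
    (X : Cover G) = (Y : Cover G) := by
  refine (Con.eq (pathCon G)).mpr ⟨⟨⟨⟨F, hF⟩, h0, h1⟩, fun s t ht => ?_⟩⟩
  rcases ht with rfl | rfl
  · exact (hl s).trans (basedPaths_apply_zero X).symm
  · exact hr s

/-- The path `t ↦ g * X t * g⁻¹`. -/
def conjPath (g : G) (X : basedPaths G) : basedPaths G :=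
  ⟨⟨fun t => g * (X : C(I, G)) t * g⁻¹, by fun_prop⟩, by
    change g * (X : C(I, G)) 0 * g⁻¹ = 1
    rw [basedPaths_apply_zero]; group⟩

theorem conjPath_apply (g : G) (X : basedPaths G) (t : I) :
    (conjPath g X : C(I, G)) t = g * (X : C(I, G)) t * g⁻¹ := rfl

/-- Conjugation in the cover by the class of `W` only involves the end point of `W`. -/
theorem coe_conj (W X : basedPaths G) :
    (W : Cover G) * (X : Cover G) * (W : Cover G)⁻¹ = (conjPath ((W : C(I, G)) 1) X : Cover G) := by
  rw [← Con.coe_mul, ← coe_inv_path, ← Con.coe_mul]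
  refine coe_eq_of_homotopy
    (fun p => (W : C(I, G)) (σ (σ p.1 * σ p.2)) * (X : C(I, G)) p.2 *
      ((W : C(I, G)) (σ (σ p.1 * σ p.2)))⁻¹) (by fun_prop) ?_ ?_ ?_ ?_
  · intro t; simp
  · intro t; simp [conjPath]
  · intro s; simp [basedPaths_apply_zero]
  · intro s; simp

/-- Classes of loops are central. -/
theorem commute_of_apply_one_eq_one {X : basedPaths G} (hX : (X : C(I, G)) 1 = 1) (f : Cover G) :
    Commute (X : Cover G) f := by
  induction f using Con.induction_on with | _ W
  have h : (X : Cover G) = ((W * X * W⁻¹ : basedPaths G) : Cover G) := by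
    refine coe_eq_of_homotopy
      (fun p => (W : C(I, G)) (p.1 * p.2) * (X : C(I, G)) p.2 *
        ((W : C(I, G)) (p.1 * p.2))⁻¹) (by fun_prop) ?_ ?_ ?_ ?_
    · intro t; simp [basedPaths_apply_zero]
    · intro t; simp
    · intro s; simp [basedPaths_apply_zero]
    · intro s; simp [hX]
  rw [Con.coe_mul, Con.coe_mul, coe_inv_path, eq_mul_inv_iff_mul_eq] at h
  exact h

/-- The initial piece `s ↦ X (t * s)` of a path. -/
def initialPath (X : basedPaths G) (t : I) : basedPaths G :=
  ⟨⟨fun s => (X : C(I, G)) (t * s), by fun_prop⟩, by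
    change (X : C(I, G)) (t * 0) = 1
    rw [mul_zero, basedPaths_apply_zero]⟩

theorem initialPath_one (X : basedPaths G) : initialPath X 1 = X := by
  ext t; simp [initialPath]

theorem initialPath_zero (X : basedPaths G) : initialPath X 0 = 1 := by
  ext t; simp [initialPath, basedPaths_apply_zero]

/-- If the paths `F r` start at `1` and depend continuously on `r`, and their end points follow
`X`, then the class of `X`, stopped at time `c r`, times the inverse of the class of `F r` does not
depend on `r`: it is represented by loops varying continuously. -/
theorem initialPath_mul_inv_eq (X : basedPaths G) (c : C(I, I)) (F : I → basedPaths G)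
    (hF : Continuous fun p : I × I => (F p.1 : C(I, G)) p.2)
    (h1 : ∀ r, (F r : C(I, G)) 1 = (X : C(I, G)) (c r)) :
    (initialPath X (c 0) : Cover G) * (F 0 : Cover G)⁻¹ =
      (initialPath X (c 1) : Cover G) * (F 1 : Cover G)⁻¹ := by
  simp only [← coe_inv_path, ← Con.coe_mul]
  refine coe_eq_of_homotopy
    (fun p => (X : C(I, G)) (c p.1 * p.2) * ((F p.1 : C(I, G)) p.2)⁻¹) ?_ ?_ ?_ ?_ ?_
  · exact ((X : C(I, G)).continuous.comp (by fun_prop)).mul hF.inv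
  · intro t; simp [initialPath]
  · intro t; simp [initialPath]
  · intro s; simp [basedPaths_apply_zero]
  · intro s; simp [initialPath, h1]

/-- A path `X` represents, up to a class in the subgroup `L`, the same class as a path in `P`, as
soon as locally along `X` paths in `P` to the points of `X` can be chosen continuously, and any
two paths in `P` with the same end point differ by a class in `L`. -/
theorem exists_mem_mul_inv_mem (X : basedPaths G) (P : Set (basedPaths G))
    (L : Subgroup (Cover G)) (hP1 : 1 ∈ P)
    (hL : ∀ Y ∈ P, ∀ Y' ∈ P, (Y : C(I, G)) 1 = (Y' : C(I, G)) 1 →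
      (Y : Cover G) * (Y' : Cover G)⁻¹ ∈ L)
    (hloc : ∀ t₀ : I, ∃ N ∈ 𝓝 t₀, ∃ F : I → basedPaths G,
      ContinuousOn (fun p : I × I => (F p.1 : C(I, G)) p.2) (N ×ˢ Set.univ) ∧
      ∀ t ∈ N, F t ∈ P ∧ (F t : C(I, G)) 1 = (X : C(I, G)) t) :
    ∃ Y ∈ P, (X : Cover G) * (Y : Cover G)⁻¹ ∈ L := by
  let A : Set I := {t | ∃ Y ∈ P, (Y : C(I, G)) 1 = (X : C(I, G)) t ∧
    (initialPath X t : Cover G) * (Y : Cover G)⁻¹ ∈ L}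
  have hA : ∀ t₀ : I, ∀ᶠ t in 𝓝 t₀, t ∈ A ↔ t₀ ∈ A := by
    intro t₀
    obtain ⟨N, hN, F, hF, hFP⟩ := hloc t₀
    have : LocallyPathConnectedSpace I := (convex_Icc (0 : ℝ) 1).locallyPathConnectedSpace
    obtain ⟨N', ⟨hN', hpc⟩, hsub⟩ := (path_connected_basis t₀).mem_iff.mp hN
    have hmem : ∀ t ∈ N', (t ∈ A ↔ (initialPath X t : Cover G) * (F t : Cover G)⁻¹ ∈ L) := by
      intro t ht
      obtain ⟨h1, h2⟩ := hFP t (hsub ht)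
      refine ⟨fun ⟨Y, hY, hY1, hYL⟩ => ?_, fun h => ⟨F t, h1, h2, h⟩⟩
      have := L.mul_mem hYL (hL Y hY _ h1 (hY1.trans h2.symm))
      rwa [← mul_assoc, inv_mul_cancel_right] at this
    filter_upwards [hN'] with t ht
    have ht₀ : t₀ ∈ N' := mem_of_mem_nhds hN'
    obtain ⟨c, hc⟩ := hpc.joinedIn t ht t₀ ht₀
    rw [hmem t ht, hmem t₀ ht₀]
    have key := initialPath_mul_inv_eq X (c : C(I, I)) (fun r => F (c r))
      (by
        have := hF.comp_continuous (f := fun p : I × I => (c p.1, p.2)) (by fun_prop)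
          (fun p => ⟨hsub (hc p.1), Set.mem_univ _⟩)
        exact this)
      (fun r => (hFP _ (hsub (hc r))).2)
    simp only [ContinuousMap.coe_coe, c.source, c.target] at key
    rw [key]
  have hclopen : IsClopen A := by
    constructor
    · rw [← isOpen_compl_iff, isOpen_iff_mem_nhds]
      intro t ht
      filter_upwards [hA t] with s hs hsA
      exact ht (hs.mp hsA)
    · rw [isOpen_iff_mem_nhds]
      intro t ht
      filter_upwards [hA t] with s hs
      exact hs.mpr ht
  have h0 : (0 : I) ∈ A := by
    refine ⟨1, hP1, ?_, ?_⟩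
    · rw [basedPaths_apply_zero]; rfl
    · rw [initialPath_zero, Con.coe_one, mul_inv_cancel]; exact L.one_mem
  have h1 : (1 : I) ∈ A := by
    rw [hclopen.eq_univ ⟨0, h0⟩]; trivial
  obtain ⟨Y, hY, -, hYL⟩ := h1
  rw [initialPath_one] at hYL
  exact ⟨Y, hY, hYL⟩

end CoverLemmas

/-! ### Unitary matrices as symplectic matrices -/

section Realify

open Matrix

variable {n : ℕ}

theorem realify_mul (U V : Matrix (Fin n) (Fin n) ℂ) :
    realify (U * V) = realify U * realify V := by
  simp only [realify, fromBlocks_multiply]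
  congr 1 <;> ext i j <;>
    simp [Matrix.mul_apply, ← Finset.sum_add_distrib, sub_eq_add_neg, ← Finset.sum_neg_distrib,
      add_comm]

theorem realify_I_smul_one : realify (Complex.I • (1 : Matrix (Fin n) (Fin n) ℂ)) =
    J (Fin n) ℝ := by
  simp only [realify, J]
  congr 1 <;> ext i j <;> by_cases h : i = j <;> simp [Matrix.one_apply, h]

theorem realify_mem_symplecticGroup {U : Matrix (Fin n) (Fin n) ℂ}
    (hU : U ∈ unitaryGroup (Fin n) ℂ) : realify U ∈ symplecticGroup (Fin n) ℝ := by
  rw [SymplecticGroup.mem_iff, ← realify_I_smul_one, ← realify_conjTranspose, ← realify_mul,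
    ← realify_mul, Matrix.mul_smul, Matrix.mul_one, Matrix.smul_mul]
  rw [mem_unitaryGroup_iff, star_eq_conjTranspose] at hU
  rw [hU]

theorem continuous_realify : Continuous (realify : Matrix (Fin n) (Fin n) ℂ → Mat n) := by
  unfold realify
  fun_prop

/-- The inclusion of `U(n)` in `Sp(2n, ℝ)`. -/
def unitaryToSp (n : ℕ) : unitaryGroup (Fin n) ℂ →* Sp n where
  toFun U := ⟨realify U, realify_mem_symplecticGroup U.2⟩
  map_one' := Subtype.ext realify_one
  map_mul' _ _ := Subtype.ext (realify_mul _ _)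

theorem continuous_unitaryToSp : Continuous (unitaryToSp n) :=
  Continuous.subtype_mk (continuous_realify.comp continuous_subtype_val) _

/-- The diagonal unitary matrices. -/
def diagUnitary (n : ℕ) : (Fin n → Circle) →* unitaryGroup (Fin n) ℂ where
  toFun d := ⟨diagonal fun j => (d j : ℂ), by
    rw [mem_unitaryGroup_iff, star_eq_conjTranspose, diagonal_conjTranspose, diagonal_mul_diagonal,
      ← diagonal_one]
    congr 1
    ext j
    simp [← Circle.coe_inv_eq_conj]⟩
  map_one' := Subtype.ext (by simp)
  map_mul' d e := Subtype.ext (by simp [diagonal_mul_diagonal])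

theorem continuous_diagUnitary : Continuous (diagUnitary n) := by
  refine Continuous.subtype_mk (Continuous.matrix_diagonal ?_) _
  fun_prop

/-- The path `t ↦ diag (e^{2πi a₁ t}, …, e^{2πi aₙ t})`. -/
noncomputable def rotPath (a : Fin n → ℝ) : basedPaths (Sp n) :=
  ⟨⟨fun t => unitaryToSp n (diagUnitary n fun j => Circle.exp (2 * Real.pi * a j * t)),
    continuous_unitaryToSp.comp (continuous_diagUnitary.comp (by fun_prop))⟩, by
    change unitaryToSp n (diagUnitary n fun j => Circle.exp (2 * Real.pi * a j * (0 : I))) = 1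
    have : (fun j : Fin n => Circle.exp (2 * Real.pi * a j * (0 : I))) = 1 := by ext; simp
    rw [this, map_one, map_one]⟩

theorem rotPath_apply (a : Fin n → ℝ) (t : I) : (rotPath a : C(I, Sp n)) t =
    unitaryToSp n (diagUnitary n fun j => Circle.exp (2 * Real.pi * a j * t)) := rfl

theorem rotPath_add (a b : Fin n → ℝ) : rotPath (a + b) = rotPath a * rotPath b := by
  refine Subtype.ext (ContinuousMap.ext fun t => ?_)
  change (rotPath (a + b) : C(I, Sp n)) t = (rotPath a : C(I, Sp n)) t * (rotPath b : C(I, Sp n)) t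
  rw [rotPath_apply, rotPath_apply, rotPath_apply, ← map_mul, ← map_mul]
  congr 2
  ext j : 1
  rw [Pi.mul_apply, ← Circle.exp_add, Pi.add_apply]
  ring_nf

theorem rotPath_one_of_int (a : Fin n → ℤ) :
    (rotPath (fun j => (a j : ℝ)) : C(I, Sp n)) 1 = 1 := by
  rw [rotPath_apply]
  have : (fun j : Fin n => Circle.exp (2 * Real.pi * a j * (1 : I))) = 1 := by
    ext j : 1
    rw [Pi.one_apply, Circle.exp_eq_one]
    exact ⟨a j, by simp; ring⟩
  rw [this, map_one, map_one]

/-- The classes of the paths `rotPath a`, as a homomorphism. -/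
noncomputable def rotClass (n : ℕ) : Multiplicative (Fin n → ℝ) →* SpCover n :=
  MonoidHom.mk' (fun a => (rotPath a.toAdd : SpCover n)) fun a b => by
    rw [toAdd_mul, rotPath_add, Con.coe_mul]

theorem rotClass_ofAdd (a : Fin n → ℝ) :
    rotClass n (Multiplicative.ofAdd a) = (rotPath a : SpCover n) := rfl

end Realify

/-! ### The cone is a conjugation invariant semigroup -/

section ConeLemmas

open Matrix

/-- Entrywise derivative within `[0, 1]` of a matrix valued function; it avoids the choice of a
norm on matrices. -/
def HasEntryDeriv {m k 𝕜 : Type*} [NormedAddCommGroup 𝕜] [NormedSpace ℝ 𝕜]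
    (A : ℝ → Matrix m k 𝕜) (A' : Matrix m k 𝕜) (t : ℝ) : Prop :=
  ∀ i j, HasDerivWithinAt (fun s => A s i j) (A' i j) (Set.Icc 0 1) t

theorem hasEntryDeriv_const {m k 𝕜 : Type*} [NormedAddCommGroup 𝕜] [NormedSpace ℝ 𝕜]
    (A : Matrix m k 𝕜) (t : ℝ) : HasEntryDeriv (fun _ => A) 0 t :=
  fun i j => hasDerivWithinAt_const t _ (A i j)

theorem HasEntryDeriv.mul {m k l 𝕜 : Type*} [Fintype k] [NormedRing 𝕜] [NormedAlgebra ℝ 𝕜]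
    {A : ℝ → Matrix m k 𝕜} {B : ℝ → Matrix k l 𝕜} {A' : Matrix m k 𝕜} {B' : Matrix k l 𝕜} {t : ℝ}
    (hA : HasEntryDeriv A A' t) (hB : HasEntryDeriv B B' t) :
    HasEntryDeriv (fun s => A s * B s) (A' * B t + A t * B') t := by
  intro i j
  simp only [Matrix.mul_apply, Matrix.add_apply]
  rw [← Finset.sum_add_distrib]
  exact HasDerivWithinAt.fun_sum fun x _ => (hA i x).mul (hB x j)

variable {n : ℕ}

/-- The matrix valued function on `ℝ` which is `X` on `[0, 1]` and constant on either side. -/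
noncomputable def pathMat (X : basedPaths (Sp n)) (s : ℝ) : Mat n :=
  (((X : C(I, Sp n)) (Set.projIcc 0 1 zero_le_one s) : Sp n) : Mat n)

theorem continuous_pathMat (X : basedPaths (Sp n)) : Continuous (pathMat X) :=
  continuous_subtype_val.comp ((X : C(I, Sp n)).continuous.comp continuous_projIcc)

theorem pathMat_mul (X Y : basedPaths (Sp n)) (s : ℝ) :
    pathMat (X * Y) s = pathMat X s * pathMat Y s := rfl

theorem pathMat_inv_mul (X : basedPaths (Sp n)) (s : ℝ) : pathMat X⁻¹ s * pathMat X s = 1 := by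
  rw [← pathMat_mul, inv_mul_cancel]; rfl

/-- A symplectic matrix `A` with inverse `B` satisfies `A J = J Bᵀ`, so that conjugation by `A`
turns the generator `J H` into `J (Bᵀ H B)`. -/
theorem mul_J_eq {A : Mat n} (hA : A ∈ symplecticGroup (Fin n) ℝ) {B : Mat n} (hBA : B * A = 1) :
    A * J (Fin n) ℝ = J (Fin n) ℝ * Bᵀ := by
  have h := SymplecticGroup.mem_iff.mp hA
  have h2 : Aᵀ * Bᵀ = 1 := by rw [← transpose_mul, hBA, transpose_one]
  conv_rhs => rw [← h, Matrix.mul_assoc _ Aᵀ, h2, Matrix.mul_one]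

theorem posSemidef_transpose_mul_mul {H : Mat n} (hH : H.PosSemidef) (B : Mat n) :
    (Bᵀ * H * B).PosSemidef := by
  have := hH.conjTranspose_mul_mul_same B
  rwa [conjTranspose_eq_transpose_of_trivial] at this

/-- If `X` and `Y` are generated by `H` and `K`, then `X Y` is generated by
`H + (X⁻¹)ᵀ K X⁻¹`. -/
theorem mul_mem_nonnegCone {f g : SpCover n} (hf : f ∈ nonnegCone n) (hg : g ∈ nonnegCone n) :
    f * g ∈ nonnegCone n := by
  obtain ⟨X, H, rfl, hHc, hHp, hX⟩ := hf
  obtain ⟨Y, K, rfl, hKc, hKp, hY⟩ := hg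
  refine ⟨X * Y, fun t => H t + (pathMat X⁻¹ t)ᵀ * K t * pathMat X⁻¹ t, rfl, ?_,
    fun t ht => (hHp t ht).add (posSemidef_transpose_mul_mul (hKp t ht) _), fun t ht => ?_⟩
  · have := (continuous_pathMat X⁻¹).continuousOn (s := Set.Icc (0 : ℝ) 1)
    fun_prop
  · have h1 : HasEntryDeriv (pathMat X) (J (Fin n) ℝ * H t * pathMat X t) t := hX t ht
    have h2 : HasEntryDeriv (pathMat Y) (J (Fin n) ℝ * K t * pathMat Y t) t := hY t ht
    have h3 := h1.mul h2
    have e : J (Fin n) ℝ * (H t + (pathMat X⁻¹ t)ᵀ * K t * pathMat X⁻¹ t) * pathMat (X * Y) t =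
        J (Fin n) ℝ * H t * pathMat X t * pathMat Y t +
          pathMat X t * (J (Fin n) ℝ * K t * pathMat Y t) := by
      have h4 := mul_J_eq (A := pathMat X t) (Subtype.property _) (pathMat_inv_mul X t)
      rw [pathMat_mul, Matrix.mul_add, Matrix.add_mul]
      simp only [← Matrix.mul_assoc]
      rw [h4]
      congr 1
      rw [Matrix.mul_assoc _ (pathMat X⁻¹ t), pathMat_inv_mul, Matrix.mul_one]
    rw [← e] at h3
    exact h3

/-- The conjugate of `f` by the class of a path `W` is represented by the conjugate by the constant
matrix `W 1`, so that `W` need not be differentiable. -/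
theorem conj_mem_nonnegCone {f : SpCover n} (hf : f ∈ nonnegCone n) (w : SpCover n) :
    w * f * w⁻¹ ∈ nonnegCone n := by
  obtain ⟨X, H, rfl, hHc, hHp, hX⟩ := hf
  induction w using Con.induction_on with | _ W
  rw [coe_conj]
  set g : Sp n := (W : C(I, Sp n)) 1
  have hg : ((g⁻¹ : Sp n) : Mat n) * (g : Mat n) = 1 := by
    have := congrArg (fun A : Sp n => (A : Mat n)) (inv_mul_cancel g)
    exact this
  refine ⟨conjPath g X, fun t => ((g⁻¹ : Sp n) : Mat n)ᵀ * H t * ((g⁻¹ : Sp n) : Mat n), rfl,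
    by fun_prop, fun t ht => posSemidef_transpose_mul_mul (hHp t ht) _, fun t ht => ?_⟩
  have h1 : HasEntryDeriv (pathMat X) (J (Fin n) ℝ * H t * pathMat X t) t := hX t ht
  have h2 := ((hasEntryDeriv_const (g : Mat n) t).mul h1).mul
    (hasEntryDeriv_const ((g⁻¹ : Sp n) : Mat n) t)
  have e : J (Fin n) ℝ * (((g⁻¹ : Sp n) : Mat n)ᵀ * H t * ((g⁻¹ : Sp n) : Mat n)) *
      pathMat (conjPath g X) t = (0 * pathMat X t + (g : Mat n) *
        (J (Fin n) ℝ * H t * pathMat X t)) * ((g⁻¹ : Sp n) : Mat n) +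
        (g : Mat n) * pathMat X t * 0 := by
    have h4 := mul_J_eq g.2 hg
    have h5 : pathMat (conjPath g X) t = (g : Mat n) * pathMat X t * ((g⁻¹ : Sp n) : Mat n) := rfl
    rw [h5, Matrix.zero_mul, Matrix.mul_zero, zero_add, add_zero]
    simp only [← Matrix.mul_assoc]
    rw [h4, Matrix.mul_assoc _ ((g⁻¹ : Sp n) : Mat n) (g : Mat n), hg, Matrix.mul_one]
  rw [← e] at h2
  exact h2

theorem HasEntryDeriv.realify {A : ℝ → Matrix (Fin n) (Fin n) ℂ} {A' : Matrix (Fin n) (Fin n) ℂ}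
    {t : ℝ} (hA : HasEntryDeriv A A' t) :
    HasEntryDeriv (fun s => SympGrowth.realify (A s)) (SympGrowth.realify A') t := by
  have hre : ∀ i j, HasDerivWithinAt (fun s => (A s i j).re) (A' i j).re (Set.Icc 0 1) t :=
    fun i j => Complex.reCLM.hasFDerivAt.comp_hasDerivWithinAt t (hA i j)
  have him : ∀ i j, HasDerivWithinAt (fun s => (A s i j).im) (A' i j).im (Set.Icc 0 1) t :=
    fun i j => Complex.imCLM.hasFDerivAt.comp_hasDerivWithinAt t (hA i j)
  rintro (i | i) (j | j)
  · exact hre i j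
  · exact (him i j).neg
  · exact him i j
  · exact hre i j

theorem rotPath_mem_nonnegCone {a : Fin n → ℝ} (ha : 0 ≤ a) :
    (rotPath a : SpCover n) ∈ nonnegCone n := by
  have hH : (SympGrowth.realify (diagonal fun j => ((2 * Real.pi * a j : ℝ) : ℂ))).PosSemidef := by
    have e : SympGrowth.realify (diagonal fun j => ((2 * Real.pi * a j : ℝ) : ℂ)) =
        diagonal (Sum.elim (fun j => 2 * Real.pi * a j) (fun j => 2 * Real.pi * a j)) := by
      rw [← fromBlocks_diagonal, SympGrowth.realify]
      congr 1 <;> ext i j <;> by_cases h : i = j <;> simp [h]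
    rw [e]
    refine PosSemidef.diagonal ?_
    rintro (j | j) <;> exact mul_nonneg (by positivity) (ha j)
  refine ⟨rotPath a, fun _ => _, rfl, continuousOn_const, fun _ _ => hH, fun t ht => ?_⟩
  have h1 : HasEntryDeriv (fun s : ℝ => diagonal fun j : Fin n =>
      Complex.exp ((2 * Real.pi * a j * s : ℝ) * Complex.I))
      (Complex.I • (1 : Matrix (Fin n) (Fin n) ℂ) *
        (diagonal fun j => ((2 * Real.pi * a j : ℝ) : ℂ)) * diagonal fun j : Fin n =>
      Complex.exp ((2 * Real.pi * a j * t : ℝ) * Complex.I)) t := by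
    intro i j
    rw [smul_mul, Matrix.one_mul, smul_mul, diagonal_mul_diagonal, Matrix.smul_apply, smul_eq_mul]
    by_cases h : i = j
    · subst h
      simp only [diagonal_apply_eq]
      have h2 : HasDerivAt (fun s : ℝ => ((2 * Real.pi * a i * s : ℝ) : ℂ) * Complex.I)
          (((2 * Real.pi * a i : ℝ) : ℂ) * Complex.I) t := by
        have := ((hasDerivAt_id t).const_mul (2 * Real.pi * a i)).ofReal_comp.mul_const Complex.I
        simpa using this
      convert h2.cexp.hasDerivWithinAt using 1
      ring
    · simp only [diagonal_apply_ne _ h, mul_zero]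
      exact hasDerivWithinAt_const _ _ _
  have h2 := h1.realify
  rw [realify_mul, realify_mul, realify_I_smul_one] at h2
  have e : ∀ s ∈ Set.Icc (0 : ℝ) 1, pathMat (rotPath a) s = SympGrowth.realify
      (diagonal fun j : Fin n => Complex.exp ((2 * Real.pi * a j * s : ℝ) * Complex.I)) := by
    intro s hs
    rw [pathMat, rotPath_apply, Set.projIcc_of_mem zero_le_one hs]
    rfl
  intro i j
  change HasDerivWithinAt (fun s => pathMat (rotPath a) s i j) ((J (Fin n) ℝ *
    SympGrowth.realify (diagonal fun j => ((2 * Real.pi * a j : ℝ) : ℂ)) *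
    pathMat (rotPath a) t : Mat n) i j) _ _
  rw [e t ht]
  exact (h2 i j).congr (fun s hs => by rw [e s hs]) (by rw [e t ht])

theorem one_mem_nonnegCone : (1 : SpCover n) ∈ nonnegCone n := by
  have := rotPath_mem_nonnegCone (le_refl (0 : Fin n → ℝ))
  rwa [← rotClass_ofAdd, ofAdd_zero, map_one] at this

end ConeLemmas

/-! ### The polar decomposition of a path -/

section Polar

open Matrix
open scoped MatrixOrder

variable {n : ℕ}

theorem sqrt_mul_sqrt {S : Mat n} (hS : S.PosDef) : CFC.sqrt S * CFC.sqrt S = S :=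
  CFC.sqrt_mul_sqrt_self S hS.posSemidef.nonneg

theorem posDef_sqrt {S : Mat n} (hS : S.PosDef) : (CFC.sqrt S).PosDef := by
  refine (CFC.sqrt_nonneg S).posSemidef.posDef_iff_isUnit.mpr ?_
  have h := hS.isUnit
  rw [Matrix.isUnit_iff_isUnit_det] at h ⊢
  rw [← sqrt_mul_sqrt hS, Matrix.det_mul] at h
  exact isUnit_of_mul_isUnit_right h

theorem transpose_eq_of_posDef {S : Mat n} (hS : S.PosDef) : Sᵀ = S := by
  have := hS.isHermitian
  rwa [Matrix.IsHermitian, Matrix.conjTranspose_eq_transpose_of_trivial] at this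

/-- The square root of a positive definite symplectic matrix `S` is symplectic: `Jᵀ √S J` and
`(√S)⁻¹` are both the square root of `S⁻¹`. -/
theorem sqrt_mem_symplecticGroup {S : Mat n} (hS : S.PosDef)
    (hSp : S ∈ symplecticGroup (Fin n) ℝ) : CFC.sqrt S ∈ symplecticGroup (Fin n) ℝ := by
  set P := CFC.sqrt S with hP
  set Jn : Mat n := J (Fin n) ℝ with hJ
  have hPd := posDef_sqrt hS
  rw [← hP] at hPd
  have hPt : Pᵀ = P := transpose_eq_of_posDef hPd
  have hJt : Jnᵀ = -Jn := J_transpose _ _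
  have hJJ : Jn * Jn = -1 := J_squared _ _
  have hJJt : Jn * Jnᵀ = 1 := by rw [hJt, mul_neg, hJJ, neg_neg]
  have hJtJ : Jnᵀ * Jn = 1 := by rw [hJt, neg_mul, hJJ, neg_neg]
  have hQ0 : (Jnᵀ * P * Jn).PosSemidef := posSemidef_transpose_mul_mul hPd.posSemidef Jn
  have hSJS : S * Jn * S = Jn := by
    have := SymplecticGroup.mem_iff.mp hSp
    rwa [transpose_eq_of_posDef hS] at this
  have hQQ : (Jnᵀ * P * Jn) * (Jnᵀ * P * Jn) = S⁻¹ := by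
    have h1 : (Jnᵀ * P * Jn) * (Jnᵀ * P * Jn) = Jnᵀ * S * Jn := by
      calc (Jnᵀ * P * Jn) * (Jnᵀ * P * Jn) = Jnᵀ * P * (Jn * Jnᵀ) * P * Jn := by
            simp only [Matrix.mul_assoc]
        _ = Jnᵀ * S * Jn := by
            rw [hJJt, Matrix.mul_one, Matrix.mul_assoc Jnᵀ, hP, sqrt_mul_sqrt hS]
    rw [h1]
    refine (Matrix.inv_eq_left_inv ?_).symm
    rw [Matrix.mul_assoc, Matrix.mul_assoc, ← Matrix.mul_assoc S, hSJS, hJtJ]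
  have hQP : Jnᵀ * P * Jn = P⁻¹ := by
    rw [hP, hS.posSemidef.inv_sqrt]
    exact (CFC.sqrt_unique hQQ hQ0.nonneg).symm
  have hdet : IsUnit P.det := (Matrix.isUnit_iff_isUnit_det P).mp hPd.isUnit
  rw [SymplecticGroup.mem_iff, hPt]
  calc P * Jn * P = Jn * (Jnᵀ * P * Jn * P) := by
        simp only [← Matrix.mul_assoc]; rw [hJJt, Matrix.one_mul]
    _ = Jn := by rw [hQP, Matrix.nonsing_inv_mul _ hdet, Matrix.mul_one]

open scoped Matrix.Norms.L2Operator in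
theorem continuousOn_sqrt_posDef :
    ContinuousOn (CFC.sqrt : Mat n → Mat n) {S | S.PosDef} :=
  CFC.continuousOn_sqrt.mono fun _ hS => hS.posSemidef.nonneg

/-- The pointwise square root of a path of positive definite symplectic matrices. -/
theorem exists_sqrt_path (P : basedPaths (Sp n))
    (hP : ∀ t, (((P : C(I, Sp n)) t : Sp n) : Mat n).PosDef) :
    ∃ R : basedPaths (Sp n), R * R = P ∧
      ∀ t, (((R : C(I, Sp n)) t : Sp n) : Mat n).PosDef := by
  refine ⟨⟨⟨fun t => ⟨CFC.sqrt (((P : C(I, Sp n)) t : Sp n) : Mat n),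
    sqrt_mem_symplecticGroup (hP t) (Subtype.property _)⟩, ?_⟩, ?_⟩, ?_, fun t => posDef_sqrt (hP t)⟩
  · refine Continuous.subtype_mk ?_ _
    exact continuousOn_sqrt_posDef.comp_continuous
      (continuous_subtype_val.comp (P : C(I, Sp n)).continuous) hP
  · refine Subtype.ext ?_
    change CFC.sqrt (((P : C(I, Sp n)) 0 : Sp n) : Mat n) = 1
    rw [basedPaths_apply_zero]
    exact CFC.sqrt_one
  · refine Subtype.ext (ContinuousMap.ext fun t => Subtype.ext ?_)
    exact sqrt_mul_sqrt (hP t)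

/-- A continuous family of symplectic matrices that are realizations of unitary ones comes from a
continuous family of unitary matrices: half the complex linear part recovers `U` from
`realify U`. -/
theorem exists_continuous_unitary (W : C(I, Sp n))
    (hW : ∀ t, ∃ U ∈ unitaryGroup (Fin n) ℂ, ((W t : Sp n) : Mat n) = realify U) :
    ∃ U : C(I, unitaryGroup (Fin n) ℂ), ∀ t, W t = unitaryToSp n (U t) := by
  have key : ∀ t, ∃ hU : (1 / 2 : ℂ) • complexPart ((W t : Sp n) : Mat n) ∈ unitaryGroup (Fin n) ℂ,
      W t = unitaryToSp n ⟨_, hU⟩ := by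
    intro t
    obtain ⟨U, hU, h⟩ := hW t
    have e : (1 / 2 : ℂ) • complexPart ((W t : Sp n) : Mat n) = U := by
      rw [h, complexPart_realify, smul_smul]; norm_num
    refine ⟨by rwa [e], Subtype.ext ?_⟩
    exact h.trans (congrArg realify e.symm)
  refine ⟨⟨fun t => ⟨_, (key t).choose⟩, ?_⟩, fun t => (key t).choose_spec⟩
  refine Continuous.subtype_mk ?_ _
  have h : Continuous fun A : Mat n => (1 / 2 : ℂ) • complexPart A := by
    unfold complexPart
    simp only [toBlocks₁₁, toBlocks₂₂, toBlocks₂₁, toBlocks₁₂]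
    fun_prop
  exact h.comp (continuous_subtype_val.comp W.continuous)

/-- The polar decomposition of a path, with the positive definite factor written as a square. -/
theorem exists_polar_path (X : basedPaths (Sp n)) :
    ∃ (U : C(I, unitaryGroup (Fin n) ℂ)) (V R : basedPaths (Sp n)), X = V * (R * R) ∧
      (∀ t, (V : C(I, Sp n)) t = unitaryToSp n (U t)) ∧
      ∀ t, (((R : C(I, Sp n)) t : Sp n) : Mat n).PosDef := by
  let S : basedPaths (Sp n) := ⟨⟨fun t => ⟨(((X : C(I, Sp n)) t : Sp n) : Mat n)ᵀ *
      (((X : C(I, Sp n)) t : Sp n) : Mat n),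
      mul_mem (SymplecticGroup.transpose_mem (Subtype.property _)) (Subtype.property _)⟩, by
    have := continuous_subtype_val.comp (X : C(I, Sp n)).continuous
    exact Continuous.subtype_mk (by fun_prop) _⟩, by
    refine Subtype.ext ?_
    change (((X : C(I, Sp n)) 0 : Sp n) : Mat n)ᵀ * (((X : C(I, Sp n)) 0 : Sp n) : Mat n) = 1
    rw [basedPaths_apply_zero]
    simp⟩
  -- the polar decomposition at time `t`
  have hpol : ∀ t, ∃ U ∈ unitaryGroup (Fin n) ℂ, ∃ P : Mat n, P.PosDef ∧
      (((X : C(I, Sp n)) t : Sp n) : Mat n) = realify U * P ∧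
      (((S : C(I, Sp n)) t : Sp n) : Mat n) = P * P := by
    intro t
    obtain ⟨U, hU, P, hP, h⟩ := exists_polar ((X : C(I, Sp n)) t)
    refine ⟨U, hU, P, hP, h, ?_⟩
    change (((X : C(I, Sp n)) t : Sp n) : Mat n)ᵀ * (((X : C(I, Sp n)) t : Sp n) : Mat n) = _
    rw [mem_unitaryGroup_iff', star_eq_conjTranspose] at hU
    rw [h, transpose_mul, ← realify_conjTranspose, transpose_eq_of_posDef hP, Matrix.mul_assoc,
      ← Matrix.mul_assoc (realify Uᴴ), ← realify_mul, hU, realify_one, Matrix.one_mul]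
  have hS : ∀ t, (((S : C(I, Sp n)) t : Sp n) : Mat n).PosDef := by
    intro t
    obtain ⟨U, hU, P, hP, h, h2⟩ := hpol t
    rw [h2]
    have := Matrix.PosDef.conjTranspose_mul_self P (Matrix.mulVec_injective_of_isUnit hP.isUnit)
    rwa [conjTranspose_eq_transpose_of_trivial, transpose_eq_of_posDef hP] at this
  obtain ⟨P, hPS, hP⟩ := exists_sqrt_path S hS
  obtain ⟨R, hRP, hR⟩ := exists_sqrt_path P hP
  obtain ⟨U, hU⟩ := exists_continuous_unitary ((X * P⁻¹ : basedPaths (Sp n)) : C(I, Sp n)) (by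
    intro t
    obtain ⟨U, hU, P', hP', h, h2⟩ := hpol t
    refine ⟨U, hU, ?_⟩
    have e : P' = (((P : C(I, Sp n)) t : Sp n) : Mat n) := by
      have h3 : (((P : C(I, Sp n)) t : Sp n) : Mat n) * (((P : C(I, Sp n)) t : Sp n) : Mat n) =
          (((S : C(I, Sp n)) t : Sp n) : Mat n) := by rw [← hPS]; rfl
      rw [← CFC.sqrt_unique h3 (hP t).posSemidef.nonneg,
        ← CFC.sqrt_unique h2.symm hP'.posSemidef.nonneg]
    have e2 : (X : C(I, Sp n)) t = unitaryToSp n ⟨U, hU⟩ * (P : C(I, Sp n)) t := by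
      refine Subtype.ext ?_
      rw [h, e]; rfl
    change (((X : C(I, Sp n)) t * ((P : C(I, Sp n)) t)⁻¹ : Sp n) : Mat n) = _
    rw [e2, mul_inv_cancel_right]
    rfl)
  refine ⟨U, X * P⁻¹, R, ?_, hU, hR⟩
  rw [hRP, inv_mul_cancel_right]

/-- Conjugation by `J` inverts positive definite symplectic matrices, so that the quarter turn `j`
satisfies `r² j = r j r⁻¹` for the class `r` of a path of such matrices. -/
theorem sq_mul_quarter_mem_nonnegCone {R : basedPaths (Sp n)}
    (hR : ∀ t, (((R : C(I, Sp n)) t : Sp n) : Mat n).PosDef) :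
    (R : SpCover n) * (R : SpCover n) * (rotPath (fun _ => 1 / 4 : Fin n → ℝ) : SpCover n) ∈
      nonnegCone n := by
  set j : SpCover n := (rotPath (fun _ => 1 / 4 : Fin n → ℝ) : SpCover n) with hj
  have hend : (((rotPath (fun _ => 1 / 4 : Fin n → ℝ) : C(I, Sp n)) 1 : Sp n) : Mat n) =
      J (Fin n) ℝ := by
    rw [rotPath_apply, ← realify_I_smul_one]
    change realify (diagonal _) = _
    congr 1
    ext a b
    have h4 : Complex.exp (2 * Real.pi * (1 / 4) * Complex.I) = Complex.I := by
      rw [show (2 * Real.pi * (1 / 4) * Complex.I : ℂ) = Real.pi / 2 * Complex.I by ring,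
        Complex.exp_pi_div_two_mul_I]
    by_cases h : a = b
    · subst h
      simpa using h4
    · simp [h]
  have key : j * (R : SpCover n) * j⁻¹ = (R : SpCover n)⁻¹ := by
    rw [hj, coe_conj, ← coe_inv_path]
    congr 1
    refine Subtype.ext (ContinuousMap.ext fun t => ?_)
    change _ * (R : C(I, Sp n)) t * _⁻¹ = ((R : C(I, Sp n)) t)⁻¹
    rw [mul_inv_eq_iff_eq_mul, eq_inv_mul_iff_mul_eq]
    refine Subtype.ext ?_
    change (((R : C(I, Sp n)) t : Sp n) : Mat n) * (((rotPath (fun _ => 1 / 4 : Fin n → ℝ) :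
      C(I, Sp n)) 1 : Sp n) * (((R : C(I, Sp n)) t : Sp n) : Mat n)) =
      (((rotPath (fun _ => 1 / 4 : Fin n → ℝ) : C(I, Sp n)) 1 : Sp n) : Mat n)
    rw [hend, ← Matrix.mul_assoc]
    have := SymplecticGroup.mem_iff.mp ((R : C(I, Sp n)) t).2
    rwa [transpose_eq_of_posDef (hR t)] at this
  have e : (R : SpCover n) * (R : SpCover n) * j = (R : SpCover n) * j * (R : SpCover n)⁻¹ := by
    have h : j * (R : SpCover n)⁻¹ = (R : SpCover n) * j := by
      rw [← mul_inv_eq_iff_eq_mul, ← conj_inv, key, inv_inv]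
    rw [mul_assoc, mul_assoc, h]
  rw [e]
  exact conj_mem_nonnegCone (rotPath_mem_nonnegCone fun _ => by norm_num) _

end Polar

/-! ### Paths of unitary matrices -/

section UnitaryPaths

open Matrix
open scoped Matrix.Norms.L2Operator

variable {n : ℕ}

/-- The path `t ↦ exp (i t L)` for a Hermitian matrix `L`. -/
noncomputable def expPath (L : selfAdjoint (Matrix (Fin n) (Fin n) ℂ)) : basedPaths (Sp n) :=
  ⟨⟨fun t => unitaryToSp n (selfAdjoint.expUnitary ((t : ℝ) • L)),
    continuous_unitaryToSp.comp (by fun_prop)⟩, by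
    change unitaryToSp n (selfAdjoint.expUnitary (((0 : I) : ℝ) • L)) = 1
    rw [Set.Icc.coe_zero, zero_smul, selfAdjoint.expUnitary_zero]
    exact map_one _⟩

theorem expPath_apply (L : selfAdjoint (Matrix (Fin n) (Fin n) ℂ)) (t : I) :
    (expPath L : C(I, Sp n)) t = unitaryToSp n (selfAdjoint.expUnitary ((t : ℝ) • L)) := rfl

theorem expPath_add {L M : selfAdjoint (Matrix (Fin n) (Fin n) ℂ)}
    (h : Commute (L : Matrix (Fin n) (Fin n) ℂ) (M : Matrix (Fin n) (Fin n) ℂ)) :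
    expPath (L + M) = expPath L * expPath M := by
  refine Subtype.ext (ContinuousMap.ext fun t => ?_)
  change (expPath (L + M) : C(I, Sp n)) t = (expPath L : C(I, Sp n)) t * (expPath M : C(I, Sp n)) t
  rw [expPath_apply, expPath_apply, expPath_apply, smul_add, Commute.expUnitary_add]
  · exact map_mul _ _ _
  · exact (h.smul_left _).smul_right _

theorem unitaryToSp_injective : Function.Injective (unitaryToSp n) := by
  intro U V h
  have h1 : realify (U : Matrix (Fin n) (Fin n) ℂ) = realify (V : Matrix (Fin n) (Fin n) ℂ) :=
    congrArg Subtype.val h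
  have h2 := congrArg complexPart h1
  rw [complexPart_realify, complexPart_realify] at h2
  exact Subtype.ext (smul_right_injective _ (two_ne_zero (α := ℂ)) h2)

theorem abs_eigenvalues_le_norm [NeZero n] {L : Matrix (Fin n) (Fin n) ℂ} (hL : L.IsHermitian)
    (j : Fin n) : |hL.eigenvalues j| ≤ ‖L‖ := by
  have h : ((hL.eigenvalues j : ℝ) : ℂ) ∈ spectrum ℂ L := by
    rw [hL.spectrum_eq_image_range]
    exact ⟨_, ⟨j, rfl⟩, rfl⟩
  simpa using spectrum.norm_le_norm_of_mem h

/-- Spectral theorem: a one-parameter group of unitary matrices is conjugate to a diagonal one. -/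
theorem exists_expPath_eq_conjPath [NeZero n] (L : selfAdjoint (Matrix (Fin n) (Fin n) ℂ)) :
    ∃ (V : unitaryGroup (Fin n) ℂ) (a : Fin n → ℝ), (∀ j, 2 * Real.pi * |a j| ≤ ‖L‖) ∧
      expPath L = conjPath (unitaryToSp n V) (rotPath a) := by
  have hL : (L : Matrix (Fin n) (Fin n) ℂ).IsHermitian := L.2
  refine ⟨hL.eigenvectorUnitary, fun j => hL.eigenvalues j / (2 * Real.pi), fun j => ?_, ?_⟩
  · have h1 : |hL.eigenvalues j| ≤ ‖L‖ := abs_eigenvalues_le_norm hL j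
    have h2 : |hL.eigenvalues j / (2 * Real.pi)| = |hL.eigenvalues j| / (2 * Real.pi) := by
      rw [abs_div, abs_of_pos Real.two_pi_pos]
    simp only [h2]
    rwa [mul_div_cancel₀ _ Real.two_pi_pos.ne']
  · refine Subtype.ext (ContinuousMap.ext fun t => ?_)
    rw [conjPath_apply, expPath_apply, rotPath_apply, ← map_inv, ← map_mul, ← map_mul]
    congr 1
    refine Subtype.ext ?_
    rw [selfAdjoint.expUnitary_coe]
    set V : Matrix (Fin n) (Fin n) ℂ := (hL.eigenvectorUnitary : Matrix (Fin n) (Fin n) ℂ) with hV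
    have hVV : star V * V = 1 := Unitary.coe_star_mul_self hL.eigenvectorUnitary
    have hVi : V⁻¹ = star V := Matrix.inv_eq_left_inv hVV
    have hVu : IsUnit V := IsUnit.of_mul_eq_one _ (mul_eq_one_comm.mp hVV)
    have e : Complex.I • ((((t : ℝ) • L : selfAdjoint (Matrix (Fin n) (Fin n) ℂ))) :
        Matrix (Fin n) (Fin n) ℂ) =
        V * diagonal (fun j => Complex.I * (t * hL.eigenvalues j)) * V⁻¹ := by
      have h2 := hL.spectral_theorem
      rw [Unitary.conjStarAlgAut_apply] at h2
      have hd : diagonal (fun j => Complex.I * ((t : ℝ) * hL.eigenvalues j)) =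
          Complex.I • (t : ℝ) • (diagonal (RCLike.ofReal ∘ hL.eigenvalues) :
            Matrix (Fin n) (Fin n) ℂ) := by
        rw [← diagonal_smul, ← diagonal_smul]
        congr 1
      rw [hVi, selfAdjoint.val_smul, hd, Matrix.mul_smul, Matrix.mul_smul, Matrix.smul_mul,
        Matrix.smul_mul, hV, ← h2]
    rw [e, Matrix.exp_conj _ _ hVu, Matrix.exp_diagonal, hVi]
    change _ = V * diagonal _ * star V
    congr 3
    ext j
    rw [Pi.coe_exp, ← Complex.exp_eq_exp_ℂ, Circle.coe_exp]
    congr 1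
    have : (Real.pi : ℂ) ≠ 0 := by exact_mod_cast Real.pi_ne_zero
    push_cast
    field_simp

/-- The scalar unitary matrix `e^{iθ}`. -/
noncomputable def scalarUnitary (n : ℕ) (θ : ℝ) : unitaryGroup (Fin n) ℂ :=
  diagUnitary n fun _ => Circle.exp θ

theorem coe_scalarUnitary (θ : ℝ) : (scalarUnitary n θ : Matrix (Fin n) (Fin n) ℂ) =
    Complex.exp (θ * Complex.I) • 1 := by
  rw [smul_one_eq_diagonal]
  rfl

theorem commute_scalarUnitary (θ : ℝ) (U : unitaryGroup (Fin n) ℂ) :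
    Commute (scalarUnitary n θ) U := by
  refine Subtype.ext ?_
  change (scalarUnitary n θ : Matrix (Fin n) (Fin n) ℂ) * (U : Matrix (Fin n) (Fin n) ℂ) =
    (U : Matrix (Fin n) (Fin n) ℂ) * (scalarUnitary n θ : Matrix (Fin n) (Fin n) ℂ)
  rw [coe_scalarUnitary, Matrix.smul_mul, Matrix.mul_smul, Matrix.one_mul, Matrix.mul_one]

theorem scalarUnitary_eq_expUnitary (θ : ℝ) :
    scalarUnitary n θ = selfAdjoint.expUnitary (θ • (1 : selfAdjoint (Matrix (Fin n) (Fin n) ℂ))) := by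
  refine Subtype.ext ?_
  rw [selfAdjoint.expUnitary_coe, selfAdjoint.val_smul]
  change (diagonal fun j => ((Circle.exp θ : Circle) : ℂ)) = _
  have : Complex.I • (θ • ((1 : selfAdjoint (Matrix (Fin n) (Fin n) ℂ)) :
      Matrix (Fin n) (Fin n) ℂ)) = diagonal fun _ => (θ : ℂ) * Complex.I := by
    rw [selfAdjoint.val_one, ← diagonal_one, ← diagonal_smul, ← diagonal_smul]
    congr 1
    ext j
    simp [mul_comm]
  rw [this, Matrix.exp_diagonal]
  congr 1
  ext j
  rw [Pi.coe_exp, ← Complex.exp_eq_exp_ℂ, Circle.coe_exp]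

/-- The spectrum of a unitary matrix omits a point of the circle. -/
theorem exists_norm_scalarUnitary_inv_mul_sub_one_lt (U : unitaryGroup (Fin n) ℂ) :
    ∃ θ : ℝ, |θ| ≤ Real.pi ∧
      ‖(((scalarUnitary n θ)⁻¹ * U : unitaryGroup (Fin n) ℂ) : Matrix (Fin n) (Fin n) ℂ) - 1‖ < 2 := by
  have hfin : (spectrum ℂ (U : Matrix (Fin n) (Fin n) ℂ)).Finite := by
    rw [← spectrum_toLpLin 2]
    exact Module.End.finite_spectrum _
  obtain ⟨w, hw⟩ : ∃ w : Circle, -(w : ℂ) ∉ spectrum ℂ (U : Matrix (Fin n) (Fin n) ℂ) := by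
    by_contra! h
    have h2 : (Set.range fun w : Circle => -(w : ℂ)).Finite :=
      hfin.subset (by rintro _ ⟨w, rfl⟩; exact h w)
    have h3 : Function.Injective fun w : Circle => -(w : ℂ) :=
      neg_injective.comp Circle.coe_injective
    have h4 : Infinite Circle := by
      refine Infinite.of_injective (fun k : ℕ => Circle.exp ((k : ℝ))) fun k l hkl => ?_
      obtain ⟨m, hm⟩ := Circle.exp_eq_exp.mp hkl
      by_contra hne
      have hm0 : (m : ℝ) ≠ 0 := by
        rintro h0
        rw [h0, zero_mul, add_zero] at hm
        exact hne (by exact_mod_cast hm)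
      refine irrational_pi.ne_rational ((k : ℤ) - l) (2 * m) ?_
      push_cast
      field_simp
      linarith
    exact Set.infinite_range_of_injective h3 h2
  refine ⟨Complex.arg w, Complex.abs_arg_le_pi _, ?_⟩
  have hwe : Circle.exp (Complex.arg w) = w := Circle.exp_arg w
  refine (Unitary.norm_sub_one_lt_two_iff (Subtype.property _)).mpr fun h => hw ?_
  have hU : (U : Matrix (Fin n) (Fin n) ℂ) =
      (Units.mk0 (w : ℂ) w.coe_ne_zero) • (((scalarUnitary n (Complex.arg w))⁻¹ * U :
        unitaryGroup (Fin n) ℂ) : Matrix (Fin n) (Fin n) ℂ) := by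
    have h1 : U = scalarUnitary n (Complex.arg w) * ((scalarUnitary n (Complex.arg w))⁻¹ * U) := by
      rw [mul_inv_cancel_left]
    conv_lhs => rw [h1]
    change (scalarUnitary n (Complex.arg w) : Matrix (Fin n) (Fin n) ℂ) * _ = _
    rw [coe_scalarUnitary, smul_mul, Matrix.one_mul, Units.smul_def, Units.val_mk0]
    congr 1
    rw [← Circle.coe_exp, hwe]
  rw [hU, show (-(w : ℂ)) = (Units.mk0 (w : ℂ) w.coe_ne_zero) • (-1 : ℂ) by
    rw [Units.smul_def, Units.val_mk0, smul_eq_mul, mul_neg_one]]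
  exact spectrum.smul_mem_smul_iff.mpr h

end UnitaryPaths

section UnitaryClasses

open Matrix
open scoped Matrix.Norms.L2Operator

variable {n : ℕ}

/-- The paths `t ↦ exp (i t L)` where `L = θ + arg u` is a logarithm of `e^{iθ} u` given by the
principal branch of the argument on the spectrum of the unitary matrix `u`. -/
def principalPaths (n : ℕ) : Set (basedPaths (Sp n)) :=
  {Y | ∃ (θ : ℝ) (u : unitaryGroup (Fin n) ℂ), |θ| ≤ Real.pi ∧
    ‖(u : Matrix (Fin n) (Fin n) ℂ) - 1‖ < 2 ∧
    Y = expPath (θ • (1 : selfAdjoint (Matrix (Fin n) (Fin n) ℂ)) + Unitary.argSelfAdjoint u)}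

theorem commute_argSelfAdjoint {u v : unitaryGroup (Fin n) ℂ} (h : Commute u v) :
    Commute (Unitary.argSelfAdjoint u : Matrix (Fin n) (Fin n) ℂ)
      (Unitary.argSelfAdjoint v : Matrix (Fin n) (Fin n) ℂ) := by
  have key : ∀ {a : unitaryGroup (Fin n) ℂ} {b : Matrix (Fin n) (Fin n) ℂ},
      Commute (a : Matrix (Fin n) (Fin n) ℂ) b →
      Commute (star (a : Matrix (Fin n) (Fin n) ℂ)) b →
      Commute (Unitary.argSelfAdjoint a : Matrix (Fin n) (Fin n) ℂ) b :=
    fun h1 h2 => h1.cfc h2 _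
  have h1 : ∀ {a b : unitaryGroup (Fin n) ℂ}, Commute a b →
      Commute (a : Matrix (Fin n) (Fin n) ℂ) (b : Matrix (Fin n) (Fin n) ℂ) :=
    fun h => congrArg Subtype.val h.eq
  have h2 : ∀ {a b : unitaryGroup (Fin n) ℂ}, Commute a b →
      Commute (star (a : Matrix (Fin n) (Fin n) ℂ)) (b : Matrix (Fin n) (Fin n) ℂ) :=
    fun h => h1 h.inv_left
  refine key ?_ ?_
  · exact (key (h1 h.symm) (h2 h.symm)).symm
  · have h3 : Commute (star (v : Matrix (Fin n) (Fin n) ℂ)) (star (u : Matrix (Fin n) (Fin n) ℂ)) :=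
      h2 h.symm.inv_right
    exact (key (h2 h).symm h3).symm

theorem commute_smul_one_add {θ φ : ℝ} {a b : selfAdjoint (Matrix (Fin n) (Fin n) ℂ)}
    (h : Commute (a : Matrix (Fin n) (Fin n) ℂ) (b : Matrix (Fin n) (Fin n) ℂ)) :
    Commute ((θ • (1 : selfAdjoint (Matrix (Fin n) (Fin n) ℂ)) + a :
      selfAdjoint (Matrix (Fin n) (Fin n) ℂ)) : Matrix (Fin n) (Fin n) ℂ)
      ((φ • (1 : selfAdjoint (Matrix (Fin n) (Fin n) ℂ)) + b :
      selfAdjoint (Matrix (Fin n) (Fin n) ℂ)) : Matrix (Fin n) (Fin n) ℂ) := by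
  have h1 : ∀ (θ : ℝ) (c : Matrix (Fin n) (Fin n) ℂ),
      Commute (θ • (1 : Matrix (Fin n) (Fin n) ℂ)) c := fun θ c => (Commute.one_left c).smul_left θ
  simp only [AddSubgroup.coe_add, selfAdjoint.val_smul, selfAdjoint.val_one]
  exact (h1 θ _).add_left ((h1 φ a).symm.add_right h)

theorem expPath_principal_one (θ : ℝ) {u : unitaryGroup (Fin n) ℂ}
    (hu : ‖(u : Matrix (Fin n) (Fin n) ℂ) - 1‖ < 2) :
    (expPath (θ • (1 : selfAdjoint (Matrix (Fin n) (Fin n) ℂ)) + Unitary.argSelfAdjoint u) :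
      C(I, Sp n)) 1 = unitaryToSp n (scalarUnitary n θ * u) := by
  rw [expPath_apply, Set.Icc.coe_one, one_smul, Commute.expUnitary_add, scalarUnitary_eq_expUnitary,
    expUnitary_argSelfAdjoint hu]
  rw [selfAdjoint.val_smul, selfAdjoint.val_one]
  exact (Commute.one_left _).smul_left θ

theorem norm_smul_one_add_argSelfAdjoint_le [NeZero n] {θ : ℝ} (hθ : |θ| ≤ Real.pi)
    (u : unitaryGroup (Fin n) ℂ) :
    ‖θ • (1 : selfAdjoint (Matrix (Fin n) (Fin n) ℂ)) + Unitary.argSelfAdjoint u‖ ≤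
      2 * Real.pi := by
  have h1 : ‖θ • (1 : selfAdjoint (Matrix (Fin n) (Fin n) ℂ))‖ ≤ Real.pi := by
    have : ‖(θ • (1 : Matrix (Fin n) (Fin n) ℂ))‖ ≤ Real.pi := by
      rw [norm_smul, norm_one, mul_one]
      exact hθ
    exact this
  have h2 := Unitary.norm_argSelfAdjoint_le_pi u
  exact (norm_add_le _ _).trans (by linarith)

theorem exists_path_to_unitary (V : unitaryGroup (Fin n) ℂ) :
    ∃ W : basedPaths (Sp n), (W : C(I, Sp n)) 1 = unitaryToSp n V := by
  obtain ⟨θ, -, h⟩ := exists_norm_scalarUnitary_inv_mul_sub_one_lt V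
  exact ⟨_, (expPath_principal_one θ h).trans (by rw [mul_inv_cancel_left])⟩

/-- A closed one-parameter group of unitary matrices is homotopic to a diagonal one. -/
theorem exists_int_of_expPath_one [NeZero n] {L : selfAdjoint (Matrix (Fin n) (Fin n) ℂ)}
    (hL : (expPath L : C(I, Sp n)) 1 = 1) :
    ∃ m : Fin n → ℤ, (expPath L : SpCover n) = (rotPath fun j => (m j : ℝ) : SpCover n) := by
  obtain ⟨V, a, -, hVa⟩ := exists_expPath_eq_conjPath L
  obtain ⟨W, hW⟩ := exists_path_to_unitary V
  have h1 : (rotPath a : C(I, Sp n)) 1 = 1 := by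
    rwa [hVa, conjPath_apply, conj_eq_one_iff] at hL
  have h2 : ∀ j, ∃ m : ℤ, a j = m := by
    intro j
    rw [rotPath_apply, ← map_one (unitaryToSp n)] at h1
    have h3 := congrArg (fun A : unitaryGroup (Fin n) ℂ => (A : Matrix (Fin n) (Fin n) ℂ) j j)
      (unitaryToSp_injective h1)
    change diagonal (fun j => ((Circle.exp (2 * Real.pi * a j * (1 : I)) : Circle) : ℂ)) j j =
      (1 : Matrix (Fin n) (Fin n) ℂ) j j at h3
    rw [diagonal_apply_eq, one_apply_eq, Circle.coe_eq_one, Circle.exp_eq_one] at h3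
    obtain ⟨m, hm⟩ := h3
    refine ⟨m, ?_⟩
    rw [Set.Icc.coe_one, mul_one, mul_comm] at hm
    exact mul_right_cancel₀ Real.two_pi_pos.ne' hm
  choose m hm using h2
  obtain rfl : a = fun j => (m j : ℝ) := funext hm
  refine ⟨m, ?_⟩
  rw [hVa, ← hW, ← coe_conj, ← (commute_of_apply_one_eq_one h1 _).eq, mul_inv_cancel_right]

/-- The classes of loops of diagonal matrices, parametrized by the winding numbers. -/
def intRotSubgroup (n : ℕ) : Subgroup (SpCover n) where
  carrier := {x | ∃ m : Fin n → ℤ, x = (rotPath fun j => (m j : ℝ) : SpCover n)}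
  mul_mem' := by
    rintro _ _ ⟨m, rfl⟩ ⟨k, rfl⟩
    refine ⟨m + k, ?_⟩
    rw [← Con.coe_mul, ← rotPath_add]
    congr 2
    ext j
    simp
  one_mem' := ⟨0, by
    rw [← map_one (rotClass n), ← ofAdd_zero, rotClass_ofAdd]
    congr 2
    ext j
    simp⟩
  inv_mem' := by
    rintro _ ⟨m, rfl⟩
    refine ⟨-m, ?_⟩
    rw [← rotClass_ofAdd, ← rotClass_ofAdd, ← map_inv, ← ofAdd_neg]
    congr 2
    ext j
    simp

/-- Principal paths with the same end point differ by a diagonal loop: the two logarithms of the end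
point commute, and the exponential of their difference is `1`. -/
theorem principalPaths_mul_inv_mem [NeZero n] {Y Y' : basedPaths (Sp n)}
    (hY : Y ∈ principalPaths n) (hY' : Y' ∈ principalPaths n)
    (h : (Y : C(I, Sp n)) 1 = (Y' : C(I, Sp n)) 1) :
    (Y : SpCover n) * (Y' : SpCover n)⁻¹ ∈ intRotSubgroup n := by
  obtain ⟨θ, u, hθ, hu, rfl⟩ := hY
  obtain ⟨φ, v, hφ, hv, rfl⟩ := hY'
  rw [expPath_principal_one θ hu, expPath_principal_one φ hv] at h
  have huv : Commute u v := by
    have h1 : u = (scalarUnitary n θ)⁻¹ * (scalarUnitary n φ * v) := by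
      rw [← unitaryToSp_injective h, inv_mul_cancel_left]
    rw [h1]
    exact (commute_scalarUnitary θ v).inv_left.mul_left
      ((commute_scalarUnitary φ v).mul_left (Commute.refl v))
  have hc := commute_smul_one_add (θ := θ) (φ := φ) (commute_argSelfAdjoint huv)
  have h0 := expPath_principal_one θ hu
  have h0' := expPath_principal_one φ hv
  rw [← h] at h0'
  generalize θ • (1 : selfAdjoint (Matrix (Fin n) (Fin n) ℂ)) + Unitary.argSelfAdjoint u = L at *
  generalize φ • (1 : selfAdjoint (Matrix (Fin n) (Fin n) ℂ)) + Unitary.argSelfAdjoint v = M at *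
  have hLM : Commute ((L - M : selfAdjoint (Matrix (Fin n) (Fin n) ℂ)) : Matrix (Fin n) (Fin n) ℂ)
      (M : Matrix (Fin n) (Fin n) ℂ) := by
    rw [AddSubgroup.coe_sub]
    exact hc.sub_left (Commute.refl _)
  have e : expPath L = expPath (L - M) * expPath M := by
    rw [← expPath_add hLM, sub_add_cancel]
  have e1 : (expPath (L - M) : C(I, Sp n)) 1 = 1 := by
    have h2 : (expPath L : C(I, Sp n)) 1 =
        (expPath (L - M) : C(I, Sp n)) 1 * (expPath M : C(I, Sp n)) 1 := by rw [e]; rfl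
    rwa [h0, h0', eq_comm, mul_eq_right] at h2
  obtain ⟨m, hm⟩ := exists_int_of_expPath_one e1
  exact ⟨m, by rw [← hm, e, Con.coe_mul, mul_inv_cancel_right]⟩

/-- Locally along a path of unitary matrices principal paths to its points can be chosen
continuously. -/
theorem exists_principalPaths_chart (U : C(I, unitaryGroup (Fin n) ℂ)) (t₀ : I) :
    ∃ N ∈ nhds t₀, ∃ F : I → basedPaths (Sp n),
      ContinuousOn (fun p : I × I => (F p.1 : C(I, Sp n)) p.2) (N ×ˢ Set.univ) ∧
      ∀ t ∈ N, F t ∈ principalPaths n ∧ (F t : C(I, Sp n)) 1 = unitaryToSp n (U t) := by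
  obtain ⟨θ, hθ, h⟩ := exists_norm_scalarUnitary_inv_mul_sub_one_lt (U t₀)
  let u : C(I, unitaryGroup (Fin n) ℂ) := ⟨fun t => (scalarUnitary n θ)⁻¹ * U t, by fun_prop⟩
  have hopen : IsOpen {t : I | ‖((u t : unitaryGroup (Fin n) ℂ) : Matrix (Fin n) (Fin n) ℂ) - 1‖ < 2} :=
    isOpen_lt (by fun_prop) continuous_const
  refine ⟨_, hopen.mem_nhds h, fun t => expPath (θ • 1 + Unitary.argSelfAdjoint (u t)), ?_, ?_⟩
  · have h1 : ContinuousOn (fun t : I => Unitary.argSelfAdjoint (u t)) {t : I |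
        ‖((u t : unitaryGroup (Fin n) ℂ) : Matrix (Fin n) (Fin n) ℂ) - 1‖ < 2} := by
      refine Unitary.continuousOn_argSelfAdjoint.comp u.continuous.continuousOn fun t ht => ?_
      rw [Metric.mem_ball, Subtype.dist_eq, dist_eq_norm]
      exact ht
    have h2 : ContinuousOn (fun p : I × I => Unitary.argSelfAdjoint (u p.1)) ({t : I |
        ‖((u t : unitaryGroup (Fin n) ℂ) : Matrix (Fin n) (Fin n) ℂ) - 1‖ < 2} ×ˢ Set.univ) :=
      h1.comp continuous_fst.continuousOn fun p hp => hp.1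
    exact continuous_unitaryToSp.comp_continuousOn
      (selfAdjoint.continuous_expUnitary.comp_continuousOn
        ((continuous_subtype_val.comp continuous_snd).continuousOn.smul
          (continuousOn_const.add h2)))
  · intro t ht
    refine ⟨⟨θ, u t, hθ, ht, rfl⟩, ?_⟩
    rw [expPath_principal_one θ ht]
    congr 1
    exact mul_inv_cancel_left _ _

/-- Every path of unitary matrices is homotopic to a diagonal loop times a path
`t ↦ exp (i t L)` with `L` bounded. -/
theorem exists_unitary_normal_form [NeZero n] (U : C(I, unitaryGroup (Fin n) ℂ))
    (V : basedPaths (Sp n)) (hV : ∀ t, (V : C(I, Sp n)) t = unitaryToSp n (U t)) :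
    ∃ (m : Fin n → ℤ) (L : selfAdjoint (Matrix (Fin n) (Fin n) ℂ)), ‖L‖ ≤ 2 * Real.pi ∧
      (V : SpCover n) = (rotPath (fun j => (m j : ℝ)) : SpCover n) * (expPath L : SpCover n) := by
  obtain ⟨Y, ⟨θ, u, hθ, hu, rfl⟩, m, hm⟩ := exists_mem_mul_inv_mem V (principalPaths n)
    (intRotSubgroup n) (by
      refine ⟨0, 1, by simp [Real.pi_pos.le], by simp, ?_⟩
      have : Unitary.argSelfAdjoint (1 : unitaryGroup (Fin n) ℂ) = 0 := by
        rw [← selfAdjoint.expUnitary_zero]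
        exact argSelfAdjoint_expUnitary (by simp [Real.pi_pos])
      rw [this, zero_smul, add_zero]
      refine Subtype.ext (ContinuousMap.ext fun t => ?_)
      rw [expPath_apply, smul_zero, selfAdjoint.expUnitary_zero]
      exact (map_one _).symm)
    (fun Y hY Y' hY' h => principalPaths_mul_inv_mem hY hY' h)
    (fun t₀ => by
      obtain ⟨N, hN, F, hF, h⟩ := exists_principalPaths_chart U t₀
      exact ⟨N, hN, F, hF, fun t ht => ⟨(h t ht).1, (h t ht).2.trans (hV t).symm⟩⟩)
  exact ⟨m, _, norm_smul_one_add_argSelfAdjoint_le hθ u, mul_inv_eq_iff_eq_mul.mp hm⟩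

end UnitaryClasses

/-! ### Normal forms in the cover and their Maslov index -/

section NormalForm

open Matrix
open scoped Matrix.Norms.L2Operator

variable {n : ℕ}

/-- Permuting the coordinates is conjugation by a permutation matrix. -/
theorem exists_rotPath_comp_perm (s : Equiv.Perm (Fin n)) (a : Fin n → ℝ) :
    ∃ V : unitaryGroup (Fin n) ℂ, rotPath (a ∘ s) = conjPath (unitaryToSp n V) (rotPath a) := by
  have hV : (1 : Matrix (Fin n) (Fin n) ℂ).submatrix s (Equiv.refl _) ∈ unitaryGroup (Fin n) ℂ := by
    rw [mem_unitaryGroup_iff, star_eq_conjTranspose, conjTranspose_submatrix, conjTranspose_one,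
      submatrix_mul_equiv, Matrix.mul_one, submatrix_one_equiv]
  refine ⟨⟨_, hV⟩, Subtype.ext (ContinuousMap.ext fun t => ?_)⟩
  rw [conjPath_apply, rotPath_apply, rotPath_apply, eq_mul_inv_iff_mul_eq, ← map_mul, ← map_mul]
  congr 1
  refine Subtype.ext ?_
  change diagonal _ * (1 : Matrix (Fin n) (Fin n) ℂ).submatrix s (Equiv.refl _) =
    (1 : Matrix (Fin n) (Fin n) ℂ).submatrix s (Equiv.refl _) * diagonal _
  ext i j
  rw [diagonal_mul, mul_diagonal]
  by_cases h : s i = j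
  · simp [← h, mul_comm]
  · simp [one_apply, h]

/-- The class of a loop of diagonal matrices only depends on the sum of the winding numbers, since
the coordinates can be permuted by conjugation. -/
theorem rotPath_eq_of_sum_eq [NeZero n] {m k : Fin n → ℤ} (h : ∑ j, m j = ∑ j, k j) :
    (rotPath (fun j => (m j : ℝ)) : SpCover n) = (rotPath (fun j => (k j : ℝ)) : SpCover n) := by
  have hadd : ∀ m k : Fin n → ℤ, (rotPath (fun j => ((m + k) j : ℝ)) : SpCover n) =
      (rotPath (fun j => (m j : ℝ)) : SpCover n) * (rotPath (fun j => (k j : ℝ)) : SpCover n) := by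
    intro m k
    rw [← Con.coe_mul, ← rotPath_add]
    congr 2
    ext j
    simp
  have hzero : (rotPath (fun j => ((0 : Fin n → ℤ) j : ℝ)) : SpCover n) = 1 := by
    have := hadd 0 0
    rwa [add_zero, left_eq_mul] at this
  let K : AddSubgroup (Fin n → ℤ) :=
    { carrier := {m | (rotPath (fun j => (m j : ℝ)) : SpCover n) = 1}
      add_mem' := fun {m k} hm hk => by
        change _ = _ at hm hk ⊢
        rw [hadd, hm, hk, one_mul]
      zero_mem' := hzero
      neg_mem' := fun {m} hm => by
        change _ = _ at hm ⊢
        have := hadd m (-m)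
        rwa [add_neg_cancel, hzero, hm, one_mul, eq_comm] at this }
  have hsingle : ∀ i, Pi.single i 1 - Pi.single 0 1 ∈ K := by
    intro i
    have e : (fun j => (((Pi.single i 1 : Fin n → ℤ) j : ℤ) : ℝ)) =
        (fun j => (((Pi.single 0 1 : Fin n → ℤ) j : ℤ) : ℝ)) ∘ Equiv.swap i 0 := by
      ext j
      simp only [Function.comp_apply, Pi.single_apply, Equiv.swap_apply_eq_iff, Equiv.swap_apply_right]
    obtain ⟨V, hV⟩ := exists_rotPath_comp_perm (Equiv.swap i 0)
      (fun j => (((Pi.single 0 1 : Fin n → ℤ) j : ℤ) : ℝ))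
    obtain ⟨W, hW⟩ := exists_path_to_unitary V
    have h1 : (rotPath (fun j => (((Pi.single i 1 : Fin n → ℤ) j : ℤ) : ℝ)) : SpCover n) =
        (rotPath (fun j => (((Pi.single 0 1 : Fin n → ℤ) j : ℤ) : ℝ)) : SpCover n) := by
      rw [e, hV, ← hW, ← coe_conj, ← (commute_of_apply_one_eq_one (rotPath_one_of_int _) _).eq,
        mul_inv_cancel_right]
    have h2 := hadd (Pi.single i 1 - Pi.single 0 1) (Pi.single 0 1)
    rw [sub_add_cancel, h1, right_eq_mul] at h2
    exact h2
  have hmem : m - k ∈ K := by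
    have e : m - k = ∑ i, (m i - k i) • (Pi.single i 1 - Pi.single 0 1 : Fin n → ℤ) := by
      have h0 : ∑ i, (m i - k i) = 0 := by rw [Finset.sum_sub_distrib, h, sub_self]
      simp only [smul_sub, Finset.sum_sub_distrib, ← Finset.sum_smul, h0, zero_smul, sub_zero]
      ext j
      simp [Pi.single_apply, Finset.sum_ite_eq]
    rw [e]
    exact K.sum_mem fun i _ => K.zsmul_mem (hsingle i) _
  have h3 := hadd (m - k) k
  rw [sub_add_cancel] at h3
  rw [h3, show (rotPath (fun j => ((m - k) j : ℝ)) : SpCover n) = 1 from hmem, one_mul]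

theorem det_diagUnitary_exp (a : Fin n → ℝ) (t : ℝ) :
    ((diagUnitary n fun j => Circle.exp (2 * Real.pi * a j * t) : unitaryGroup (Fin n) ℂ) :
      Matrix (Fin n) (Fin n) ℂ).det =
      Complex.exp (2 * Real.pi * ((t * ∑ j, a j : ℝ) : ℂ) * Complex.I) := by
  change (diagonal fun j => ((Circle.exp (2 * Real.pi * a j * t) : Circle) : ℂ)).det = _
  rw [det_diagonal]
  simp only [Circle.coe_exp]
  rw [← Complex.exp_sum]
  congr 1
  push_cast
  simp only [Finset.mul_sum, Finset.sum_mul]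
  exact Finset.sum_congr rfl fun j _ => by ring

/-- The Maslov index of a normal form can be read off: its unitary part is explicit. -/
theorem maslov_normal_form (a b : Fin n → ℝ) (V : unitaryGroup (Fin n) ℂ) {R : basedPaths (Sp n)}
    (hR : ∀ t, (((R : C(I, Sp n)) t : Sp n) : Mat n).PosDef) :
    maslov ((rotPath a * conjPath (unitaryToSp n V) (rotPath b) * (R * R) : basedPaths (Sp n)) :
      SpCover n) = ∑ j, a j + ∑ j, b j := by
  have h : IsPhase (rotPath a * conjPath (unitaryToSp n V) (rotPath b) * (R * R))
      ⟨fun t => t * (∑ j, a j + ∑ j, b j), by fun_prop⟩ := by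
    intro t
    let A : unitaryGroup (Fin n) ℂ := diagUnitary n fun j => Circle.exp (2 * Real.pi * a j * t)
    let B : unitaryGroup (Fin n) ℂ := diagUnitary n fun j => Circle.exp (2 * Real.pi * b j * t)
    have hRt := transpose_eq_of_posDef (hR t)
    have hP := Matrix.PosDef.conjTranspose_mul_self _
      (Matrix.mulVec_injective_of_isUnit (hR t).isUnit)
    rw [conjTranspose_eq_transpose_of_trivial, hRt] at hP
    refine ⟨(A * (V * B * V⁻¹) : unitaryGroup (Fin n) ℂ), Subtype.property _, _, hP, ?_, ?_⟩
    · have e : (rotPath a : C(I, Sp n)) t * (conjPath (unitaryToSp n V) (rotPath b) : C(I, Sp n)) t =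
          unitaryToSp n (A * (V * B * V⁻¹)) := by
        rw [conjPath_apply, rotPath_apply, rotPath_apply, map_mul, map_mul, map_mul, map_inv]
      change (((rotPath a : C(I, Sp n)) t * (conjPath (unitaryToSp n V) (rotPath b) :
        C(I, Sp n)) t : Sp n) : Mat n) * _ = _
      rw [e]
      rfl
    · have hdet : ((A * (V * B * V⁻¹) : unitaryGroup (Fin n) ℂ) : Matrix (Fin n) (Fin n) ℂ).det =
          (A : Matrix (Fin n) (Fin n) ℂ).det * (B : Matrix (Fin n) (Fin n) ℂ).det := by
        have hV : (V : Matrix (Fin n) (Fin n) ℂ).det * (star (V : Matrix (Fin n) (Fin n) ℂ)).det =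
            1 := by
          rw [← det_mul, Unitary.mul_star_self_of_mem V.2, det_one]
        change ((A : Matrix (Fin n) (Fin n) ℂ) * ((V : Matrix (Fin n) (Fin n) ℂ) *
          (B : Matrix (Fin n) (Fin n) ℂ) * star (V : Matrix (Fin n) (Fin n) ℂ))).det = _
        rw [det_mul, det_mul, det_mul]
        linear_combination (A : Matrix (Fin n) (Fin n) ℂ).det *
          (B : Matrix (Fin n) (Fin n) ℂ).det * hV
      rw [hdet, det_diagUnitary_exp, det_diagUnitary_exp, ← Complex.exp_add]
      congr 1
      simp only [ContinuousMap.coe_mk]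
      push_cast
      ring
  rw [maslov_coe h]
  simp

/-- The class of the full rotation `t ↦ e^{2πit}`, a central element of the cone. -/
noncomputable def fullRotation (n : ℕ) : SpCover n := (rotPath (fun _ => 1 : Fin n → ℝ) : SpCover n)

theorem commute_fullRotation (f : SpCover n) : Commute (fullRotation n) f :=
  commute_of_apply_one_eq_one (by simpa using rotPath_one_of_int (fun _ : Fin n => 1)) f

theorem fullRotation_zpow (q : ℤ) :
    fullRotation n ^ q = (rotPath (fun _ => (q : ℝ) : Fin n → ℝ) : SpCover n) := by
  rw [fullRotation, ← rotClass_ofAdd, ← rotClass_ofAdd, ← map_zpow, ← ofAdd_zsmul]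
  congr 2
  ext j
  simp

theorem maslov_fullRotation_zpow (q : ℤ) : maslov (fullRotation n ^ q) = n * q := by
  have h := maslov_normal_form (fun _ => (q : ℝ) : Fin n → ℝ) 0 1 (R := 1) fun t => by
    change (1 : Mat n).PosDef
    exact PosDef.one
  have e : conjPath (unitaryToSp n 1) (rotPath (0 : Fin n → ℝ)) = 1 := by
    refine Subtype.ext (ContinuousMap.ext fun t => ?_)
    have h0 : (fun j : Fin n => Circle.exp (2 * Real.pi * (0 : Fin n → ℝ) j * t)) = 1 := by
      ext j
      simp
    rw [conjPath_apply, rotPath_apply, h0]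
    simp
  rw [e, mul_one, mul_one, mul_one, ← fullRotation_zpow] at h
  rw [h]
  simp

theorem isBetween_of_mul_mem {K : ℕ} {f : SpCover n}
    (h1 : (rotPath (fun _ => (K : ℝ) : Fin n → ℝ) : SpCover n) * f ∈ nonnegCone n)
    (h2 : (rotPath (fun _ => (K : ℝ) : Fin n → ℝ) : SpCover n) * f⁻¹ ∈ nonnegCone n) :
    IsBetween (nonnegCone n) (fullRotation n) K f := by
  rw [IsBetween, ← zpow_natCast, fullRotation_zpow]
  exact ⟨by exact_mod_cast h1, by exact_mod_cast h2⟩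

theorem isBetween_rotPath {K : ℕ} {a : Fin n → ℝ} (ha : ∀ j, |a j| ≤ K) :
    IsBetween (nonnegCone n) (fullRotation n) K (rotPath a : SpCover n) := by
  refine isBetween_of_mul_mem ?_ ?_
  · rw [← Con.coe_mul, ← rotPath_add]
    exact rotPath_mem_nonnegCone fun j => by
      have := (abs_le.mp (ha j)).1
      simp only [Pi.zero_apply, Pi.add_apply]
      linarith
  · rw [← rotClass_ofAdd, ← rotClass_ofAdd, ← map_inv, ← ofAdd_neg, ← map_mul, ← ofAdd_add,
      rotClass_ofAdd]
    exact rotPath_mem_nonnegCone fun j => by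
      have := (abs_le.mp (ha j)).2
      simp only [Pi.zero_apply, Pi.add_apply, Pi.neg_apply]
      linarith

theorem IsBetween.conj {K : ℕ} {f : SpCover n}
    (h : IsBetween (nonnegCone n) (fullRotation n) K f) (w : SpCover n) :
    IsBetween (nonnegCone n) (fullRotation n) K (w * f * w⁻¹) := by
  have key : ∀ g : SpCover n, fullRotation n ^ K * (w * g * w⁻¹) =
      w * (fullRotation n ^ K * g) * w⁻¹ := by
    intro g
    have := ((commute_fullRotation w).pow_left K).eq
    simp only [← mul_assoc]
    rw [this]
  refine ⟨?_, ?_⟩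
  · rw [key]
    exact conj_mem_nonnegCone h.1 w
  · rw [conj_inv, key]
    exact conj_mem_nonnegCone h.2 w

/-- The quarter turn of `sq_mul_quarter_mem_nonnegCone` is completed to a full one by three quarters
of a turn, which lie in the cone. -/
theorem isBetween_sq_of_posDef {R : basedPaths (Sp n)}
    (hR : ∀ t, (((R : C(I, Sp n)) t : Sp n) : Mat n).PosDef) :
    IsBetween (nonnegCone n) (fullRotation n) 1 ((R * R : basedPaths (Sp n)) : SpCover n) := by
  have key : ∀ f : SpCover n, f * (rotPath (fun _ => 1 / 4 : Fin n → ℝ) : SpCover n) ∈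
      nonnegCone n → (rotPath (fun _ => ((1 : ℕ) : ℝ) : Fin n → ℝ) : SpCover n) * f ∈
      nonnegCone n := by
    intro f hf
    have h1 := mul_mem_nonnegCone hf
      (rotPath_mem_nonnegCone (a := fun _ : Fin n => (3 / 4 : ℝ)) fun _ => by norm_num)
    rw [mul_assoc, ← Con.coe_mul, ← rotPath_add] at h1
    have e : ((fun _ => 1 / 4) + fun _ => 3 / 4 : Fin n → ℝ) = fun _ => 1 := by
      ext
      norm_num
    rw [e] at h1
    have h2 := (commute_fullRotation f).eq
    rw [fullRotation] at h2
    rwa [Nat.cast_one, h2]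
  refine isBetween_of_mul_mem (key _ (sq_mul_quarter_mem_nonnegCone hR)) (key _ ?_)
  have hinv : ∀ t, ((((R⁻¹ : basedPaths (Sp n)) : C(I, Sp n)) t : Sp n) : Mat n).PosDef := by
    intro t
    have h1 : ((((R⁻¹ : basedPaths (Sp n)) : C(I, Sp n)) t : Sp n) : Mat n) =
        (((R : C(I, Sp n)) t : Sp n) : Mat n)⁻¹ := by
      refine (Matrix.inv_eq_left_inv ?_).symm
      exact congrArg Subtype.val (inv_mul_cancel ((R : C(I, Sp n)) t))
    rw [h1]
    exact (hR t).inv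
  rw [← coe_inv_path, _root_.mul_inv_rev, Con.coe_mul]
  exact sq_mul_quarter_mem_nonnegCone hinv

/-- Every element of the cover is a power of the full rotation up to a bounded factor, and the
exponent determines the Maslov index up to a bounded error. -/
theorem exists_isBetween_and_abs_maslov_sub_le [NeZero n] (f : SpCover n) :
    ∃ q : ℤ, IsBetween (nonnegCone n) (fullRotation n) (n + 1 + 1) (fullRotation n ^ (-q) * f) ∧
      |maslov f - n * q| ≤ 2 * n := by
  induction f using Con.induction_on with | _ X
  obtain ⟨U, V, R, rfl, hV, hR⟩ := exists_polar_path X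
  obtain ⟨m, L, hL, hVmL⟩ := exists_unitary_normal_form U V hV
  obtain ⟨v, a, ha, hLa⟩ := exists_expPath_eq_conjPath L
  obtain ⟨w, hw⟩ := exists_path_to_unitary v
  have ha1 : ∀ j, |a j| ≤ 1 := fun j => by
    have := (ha j).trans hL
    rwa [mul_le_iff_le_one_right Real.two_pi_pos] at this
  have hn : (0 : ℤ) < n := by exact_mod_cast NeZero.pos n
  set M := ∑ j, m j with hM
  -- the winding numbers are redistributed: `M / n` for every coordinate, and the remainder for one
  let b : Fin n → ℤ := Pi.single 0 (M % n)
  have hb0 : ∀ j, |(b j : ℝ)| ≤ n := by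
    intro j
    have h1 := Int.emod_nonneg M hn.ne'
    have h2 := (Int.emod_lt_of_pos M hn).le
    have : 0 ≤ b j ∧ b j ≤ n := by
      by_cases h : j = 0
      · subst h; simpa [b] using ⟨h1, h2⟩
      · simp [b, h]
    rw [abs_of_nonneg (by exact_mod_cast this.1)]
    exact_mod_cast this.2
  have hrot : (rotPath (fun j => (m j : ℝ)) : SpCover n) =
      fullRotation n ^ (M / n) * (rotPath (fun j => (b j : ℝ)) : SpCover n) := by
    rw [fullRotation_zpow, ← Con.coe_mul, ← rotPath_add]
    have e : ((fun _ => ((M / n : ℤ) : ℝ)) + fun j => (b j : ℝ) : Fin n → ℝ) =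
        fun j => (((M / n : ℤ) + b j : ℤ) : ℝ) := by
      ext j
      simp
    rw [e]
    refine rotPath_eq_of_sum_eq ?_
    rw [Finset.sum_add_distrib, Finset.sum_const, Finset.card_univ, Fintype.card_fin, nsmul_eq_mul,
      Finset.sum_pi_single']
    simp [Int.mul_ediv_add_emod, ← hM]
  refine ⟨M / n, ?_, ?_⟩
  · rw [Con.coe_mul, hVmL, hrot, hLa, ← hw, ← coe_conj, _root_.zpow_neg,
      mul_assoc (fullRotation n ^ (M / n)), mul_assoc (fullRotation n ^ (M / n)),
      inv_mul_cancel_left]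
    exact ((isBetween_rotPath hb0).mul (fun _ hf _ hg => mul_mem_nonnegCone hf hg)
      commute_fullRotation ((isBetween_rotPath (by simpa using ha1)).conj _)).mul
      (fun _ hf _ hg => mul_mem_nonnegCone hf hg) commute_fullRotation (isBetween_sq_of_posDef hR)
  · have e : ((V * (R * R) : basedPaths (Sp n)) : SpCover n) =
        ((rotPath (fun j => (m j : ℝ)) * conjPath (unitaryToSp n v) (rotPath a) * (R * R) :
          basedPaths (Sp n)) : SpCover n) := by
      simp only [Con.coe_mul, hVmL, hLa]
    have h1 : |∑ j, a j| ≤ n := by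
      refine (Finset.abs_sum_le_sum_abs _ _).trans ((Finset.sum_le_sum fun j _ => ha1 j).trans ?_)
      simp
    have h2 : (∑ j, (m j : ℝ)) = n * (M / n : ℤ) + (M % n : ℤ) := by
      rw [← Int.cast_sum, ← hM]
      exact_mod_cast (Int.mul_ediv_add_emod M n).symm
    have h3 : (0 : ℝ) ≤ (M % n : ℤ) := by exact_mod_cast Int.emod_nonneg M hn.ne'
    have h4 : ((M % n : ℤ) : ℝ) ≤ n := by exact_mod_cast (Int.emod_lt_of_pos M hn).le
    rw [e, maslov_normal_form _ _ _ hR, h2]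
    rw [abs_le] at *
    constructor <;> linarith

end NormalForm

/-! ### The Maslov quasimorphism is nonnegative on the cone -/

section Phase

open Matrix

/-- A continuous argument of a complex function whose logarithmic derivative has nonnegative
imaginary part does not decrease. -/
theorem arg_le_of_logDeriv_im_nonneg {f c : ℝ → ℂ} {r β : ℝ → ℝ}
    (hβ : ContinuousOn β (Set.Icc 0 1)) (hr : ∀ s ∈ Set.Icc (0 : ℝ) 1, 0 < r s)
    (hf : ∀ s ∈ Set.Icc (0 : ℝ) 1, f s = r s * Complex.exp (β s * Complex.I))
    (hf' : ∀ s ∈ Set.Icc (0 : ℝ) 1, HasDerivWithinAt f (f s * c s) (Set.Icc 0 1) s)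
    (hc : ∀ s ∈ Set.Icc (0 : ℝ) 1, 0 ≤ (c s).im) : β 0 ≤ β 1 := by
  have hmono : MonotoneOn β (Set.Icc 0 1) := by
    refine monotoneOn_of_hasDerivWithinAt_nonneg (f' := fun s => (c s).im) (convex_Icc 0 1) hβ ?_
      fun s hs => hc s (interior_subset hs)
    intro s hs
    have hs' := interior_subset hs
    have hnhds : Set.Icc (0 : ℝ) 1 ∈ nhds s := mem_interior_iff_mem_nhds.mp hs
    refine HasDerivAt.hasDerivWithinAt ?_
    have hne : f s ≠ 0 := by
      rw [hf s hs']
      exact mul_ne_zero (by exact_mod_cast (hr s hs').ne') (Complex.exp_ne_zero _)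
    -- near `s` the argument is `β s` plus the principal argument of `f / f s`
    have h1 : HasDerivAt (fun x => (Complex.log (f x / f s)).im) (c s).im s := by
      have h2 : HasDerivAt (fun x => f x / f s) (c s) s := by
        have := ((hf' s hs').hasDerivAt hnhds).div_const (f s)
        rwa [mul_div_cancel_left₀ _ hne] at this
      have h3 := h2.clog_real (by rw [div_self hne]; exact Complex.one_mem_slitPlane)
      rw [div_self hne, div_one] at h3
      exact Complex.imCLM.hasFDerivAt.comp_hasDerivAt s h3
    have h4 : ∀ᶠ x in nhds s, β x = (Complex.log (f x / f s)).im + β s := by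
      have hcont : ContinuousAt β s := hβ.continuousAt hnhds
      have h5 := Metric.continuousAt_iff'.mp hcont Real.pi Real.pi_pos
      filter_upwards [h5, hnhds] with x hx hx1
      rw [Real.dist_eq, abs_lt] at hx
      have h6 : f x / f s = ((r x / r s : ℝ) : ℂ) *
          (Complex.cos ((β x - β s : ℝ) : ℂ) + Complex.sin ((β x - β s : ℝ) : ℂ) * Complex.I) := by
        rw [← Complex.exp_mul_I, hf x hx1, hf s hs', Complex.ofReal_sub, sub_mul, Complex.exp_sub,
          Complex.ofReal_div, mul_div_mul_comm]
      rw [Complex.log_im, h6, Complex.arg_mul_cos_add_sin_mul_I (div_pos (hr x hx1) (hr s hs'))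
        ⟨hx.1, hx.2.le⟩, sub_add_cancel]
    exact (h1.add_const (β s)).congr_of_eventuallyEq h4
  exact hmono (by simp) (by simp) zero_le_one

/-- Jacobi's formula. -/
theorem HasEntryDeriv.det {m : Type*} [Fintype m] [DecidableEq m] {A : ℝ → Matrix m m ℂ}
    {A' : Matrix m m ℂ} {t : ℝ} (hA : HasEntryDeriv A A' t) :
    HasDerivWithinAt (fun s => (A s).det) ((A t).adjugate * A').trace (Set.Icc 0 1) t := by
  have h1 : HasDerivWithinAt (fun s => (A s).det) (∑ p : Equiv.Perm m, ((p.sign : ℤ) : ℂ) *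
      ∑ i, (∏ j ∈ Finset.univ.erase i, A t (p j) j) • A' (p i) i) (Set.Icc 0 1) t := by
    simp only [det_apply']
    exact HasDerivWithinAt.fun_sum fun p _ =>
      (HasDerivWithinAt.fun_finsetProd fun i _ => hA (p i) i).const_mul _
  convert h1 using 1
  have h2 : ∀ i, ((A t).adjugate * A') i i = ((A t).updateCol i (A'.col i)).det := by
    intro i
    rw [← cramer_apply, cramer_eq_adjugate_mulVec]
    rfl
  rw [trace]
  simp only [diag_apply, h2, det_apply']
  rw [Finset.sum_comm]
  refine Finset.sum_congr rfl fun p _ => ?_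
  rw [Finset.mul_sum]
  refine Finset.sum_congr rfl fun i _ => ?_
  rw [← Finset.mul_prod_erase _ _ (Finset.mem_univ i), updateCol_self, smul_eq_mul]
  congr 1
  rw [mul_comm]
  congr 1
  refine Finset.prod_congr rfl fun j hj => ?_
  rw [updateCol_ne (Finset.ne_of_mem_erase hj)]

variable {n : ℕ}

theorem realify_complexPart (A : Mat n) :
    realify (complexPart A) = A + (J (Fin n) ℝ)ᵀ * A * J (Fin n) ℝ := by
  obtain ⟨a, b, c, d, rfl⟩ : ∃ a b c d, A = fromBlocks a b c d :=
    ⟨_, _, _, _, (fromBlocks_toBlocks A).symm⟩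
  rw [J, fromBlocks_transpose, fromBlocks_multiply, fromBlocks_multiply, fromBlocks_add, realify]
  congr 1 <;> ext i j <;> simp [complexPart] <;> ring

theorem complexPart_mul_realify (A : Mat n) (Z : Matrix (Fin n) (Fin n) ℂ) :
    complexPart (A * realify Z) = complexPart A * Z := by
  obtain ⟨a, b, c, d, rfl⟩ : ∃ a b c d, A = fromBlocks a b c d :=
    ⟨_, _, _, _, (fromBlocks_toBlocks A).symm⟩
  ext i j
  simp only [complexPart, realify, fromBlocks_multiply, toBlocks_fromBlocks₁₁,
    toBlocks_fromBlocks₂₂, toBlocks_fromBlocks₂₁, toBlocks_fromBlocks₁₂, Matrix.add_apply,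
    Matrix.smul_apply, Matrix.map_apply, Matrix.mul_apply, Matrix.sub_apply, Matrix.neg_apply,
    smul_eq_mul]
  simp only [Complex.ofReal_add, Complex.ofReal_sub, Complex.ofReal_sum, Complex.ofReal_mul,
    Complex.ofReal_neg]
  simp only [← Finset.sum_add_distrib, ← Finset.sum_sub_distrib, Finset.mul_sum]
  refine Finset.sum_congr rfl fun k _ => ?_
  conv_rhs => rw [← Complex.re_add_im (Z k j)]
  linear_combination (-((Z k j).im : ℂ) * ((c i k : ℂ) - (b i k : ℂ))) * Complex.I_sq

theorem complexPart_J_mul (A : Mat n) : complexPart (J (Fin n) ℝ * A) = Complex.I • complexPart A := by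
  rw [← realify_I_smul_one, complexPart_realify_mul, smul_mul, Matrix.one_mul]

theorem trace_complexPart_re (A : Mat n) : (complexPart A).trace.re = A.trace := by
  obtain ⟨a, b, c, d, rfl⟩ : ∃ a b c d, A = fromBlocks a b c d :=
    ⟨_, _, _, _, (fromBlocks_toBlocks A).symm⟩
  simp [complexPart, trace, Finset.sum_add_distrib]

open scoped MatrixOrder in
theorem trace_mul_nonneg_of_posSemidef {H K : Mat n} (hH : H.PosSemidef) (hK : K.PosSemidef) :
    0 ≤ (H * K).trace := by
  obtain ⟨B, hB⟩ := CStarAlgebra.nonneg_iff_eq_star_mul_self.mp hH.nonneg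
  rw [hB, Matrix.mul_assoc, trace_mul_comm]
  exact (hK.mul_mul_conjTranspose_same B).trace_nonneg

/-- If `Z` inverts the complex linear part of a symplectic matrix `A`, then `A Z` is positive
semidefinite: it equals `(A Z)ᵀ (A Z) + Zᵀ Z`. -/
theorem posSemidef_mul_realify {A : Mat n} (hA : A ∈ symplecticGroup (Fin n) ℝ)
    {Z : Matrix (Fin n) (Fin n) ℂ} (hZ : complexPart A * Z = 1) : (A * realify Z).PosSemidef := by
  set Jn : Mat n := J (Fin n) ℝ with hJ
  set W : Mat n := realify Z with hW
  have hJt : Jnᵀ = -Jn := J_transpose _ _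
  have hJJ : Jn * Jn = -1 := J_squared _ _
  have hJW : Jn * W = W * Jn := by
    rw [hJ, hW, ← realify_I_smul_one, ← realify_mul, ← realify_mul, Matrix.smul_mul,
      Matrix.mul_smul, Matrix.one_mul, Matrix.mul_one]
  have h1 : A * W + Jnᵀ * (A * W) * Jn = 1 := by
    rw [hJ, ← realify_complexPart, complexPart_mul_realify, hZ, realify_one]
  have h2 : Aᵀ * Jn * A = Jn := SymplecticGroup.mem_iff'.mp hA
  have h3 : (A * W)ᵀ = (A * W)ᵀ * (A * W) + Wᵀ * W := by
    calc (A * W)ᵀ = (A * W)ᵀ * (A * W + Jnᵀ * (A * W) * Jn) := by rw [h1, Matrix.mul_one]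
      _ = (A * W)ᵀ * (A * W) - Wᵀ * (Aᵀ * Jn * A) * W * Jn := by
        rw [Matrix.mul_add, hJt, transpose_mul]
        simp only [Matrix.mul_assoc, Matrix.neg_mul, Matrix.mul_neg, sub_eq_add_neg]
      _ = (A * W)ᵀ * (A * W) + Wᵀ * W := by
        rw [h2, Matrix.mul_assoc Wᵀ Jn W, hJW, Matrix.mul_assoc, Matrix.mul_assoc, hJJ,
          Matrix.mul_neg, Matrix.mul_one, Matrix.mul_neg, sub_neg_eq_add]
  have h4 : ∀ B : Mat n, (Bᵀ * B).PosSemidef := fun B => by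
    have := Matrix.posSemidef_conjTranspose_mul_self B
    rwa [conjTranspose_eq_transpose_of_trivial] at this
  have h5 : ((A * W)ᵀ).PosSemidef := by
    rw [h3]
    exact (h4 _).add (h4 _)
  simpa using h5.transpose

theorem HasEntryDeriv.complexPart {A : ℝ → Mat n} {A' : Mat n} {t : ℝ} (hA : HasEntryDeriv A A' t) :
    HasEntryDeriv (fun s => SympGrowth.complexPart (A s)) (SympGrowth.complexPart A') t := by
  intro i j
  exact ((hA (.inl i) (.inl j)).add (hA (.inr i) (.inr j))).ofReal_comp.add
    (((hA (.inr i) (.inl j)).sub (hA (.inl i) (.inr j))).ofReal_comp.const_mul Complex.I)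

/-- Along a path generated by a positive semidefinite Hamiltonian `H`, the logarithmic derivative
of the determinant of the complex linear part `C` has imaginary part `tr (H X C⁻¹) ≥ 0`. -/
theorem maslov_nonneg {f : SpCover n} (hf : f ∈ nonnegCone n) : 0 ≤ maslov f := by
  obtain ⟨X, H, rfl, -, hH, hX⟩ := hf
  obtain ⟨α, hα⟩ := exists_isPhase X
  rw [maslov_coe hα, sub_nonneg]
  have hpol : ∀ s ∈ Set.Icc (0 : ℝ) 1, ∃ r : ℝ, 0 < r ∧ (complexPart (pathMat X s)).det = r *
      Complex.exp ((2 * Real.pi * α (Set.projIcc 0 1 zero_le_one s) : ℝ) * Complex.I) := by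
    intro s _
    obtain ⟨U, -, P, hP, h, hdet⟩ := hα (Set.projIcc 0 1 zero_le_one s)
    obtain ⟨r, hr, hPr⟩ := complexPart_det_pos hP
    refine ⟨r, hr, ?_⟩
    rw [pathMat, h, complexPart_realify_mul, det_mul, hPr, ← hdet, mul_comm]
    push_cast
    ring_nf
  choose! r hr hdet using hpol
  have hunit : ∀ s ∈ Set.Icc (0 : ℝ) 1, IsUnit (complexPart (pathMat X s)).det := by
    intro s hs
    rw [isUnit_iff_ne_zero, hdet s hs]
    exact mul_ne_zero (by exact_mod_cast (hr s hs).ne') (Complex.exp_ne_zero _)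
  have key := arg_le_of_logDeriv_im_nonneg (f := fun s => (complexPart (pathMat X s)).det)
    (c := fun s => Complex.I *
      (complexPart (H s * (pathMat X s * realify (complexPart (pathMat X s))⁻¹))).trace)
    (r := r) (β := fun s => 2 * Real.pi * α (Set.projIcc 0 1 zero_le_one s))
    (by
      have := α.continuous.comp (continuous_projIcc (h := zero_le_one (α := ℝ)))
      exact (continuous_const.mul this).continuousOn)
    hr hdet ?_ ?_
  · simp only [Set.projIcc_left, Set.projIcc_right] at key
    exact le_of_mul_le_mul_left key Real.two_pi_pos
  · intro s hs
    have h1 : HasEntryDeriv (pathMat X) (J (Fin n) ℝ * H s * pathMat X s) s := hX s hs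
    convert h1.complexPart.det using 1
    have h2 : (complexPart (pathMat X s)).adjugate =
        (complexPart (pathMat X s)).det • (complexPart (pathMat X s))⁻¹ := by
      rw [inv_def, smul_smul, Ring.mul_inverse_cancel _ (hunit s hs), one_smul]
    rw [h2, Matrix.mul_assoc, complexPart_J_mul, Matrix.smul_mul, Matrix.mul_smul, trace_smul, trace_smul,
      ← Matrix.mul_assoc (H s), complexPart_mul_realify, trace_mul_comm]
    simp only [smul_eq_mul]
  · intro s hs
    have h1 := posSemidef_mul_realify (A := pathMat X s) (Subtype.property _)
      (Matrix.mul_nonsing_inv _ (hunit s hs))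
    rw [Complex.I_mul_im, trace_complexPart_re]
    exact trace_mul_nonneg_of_posSemidef (hH s hs) h1

end Phase

end SympGrowth

open SympGrowth

/-- For dominants `X`, `Y` of the cone of nonnegative elements of the universal cover of
`Sp(2n, ℝ)`: the limits defining `μ̃(X)`, `μ̃(Y)` and `γ(X, Y)` exist, the infima in `γ(X, Y)` are
over nonempty sets bounded below, `μ̃(X) ≠ 0`, and `γ(X, Y) = μ̃(Y) / μ̃(X)`. -/
theorem theorem2p9 (n : ℕ) (X Y : SympGrowth.SpCover n)
    (hX : SympGrowth.IsDominant (SympGrowth.nonnegCone n) X)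
    (hY : SympGrowth.IsDominant (SympGrowth.nonnegCone n) Y) :
    Filter.Tendsto (fun k : ℕ => SympGrowth.maslov (X ^ k) / (k : ℝ)) Filter.atTop
        (nhds (SympGrowth.homMaslov X)) ∧
    Filter.Tendsto (fun k : ℕ => SympGrowth.maslov (Y ^ k) / (k : ℝ)) Filter.atTop
        (nhds (SympGrowth.homMaslov Y)) ∧
    SympGrowth.homMaslov X ≠ 0 ∧
    (∀ k : ℕ, (SympGrowth.growthSet (SympGrowth.nonnegCone n) X Y k).Nonempty ∧
      BddBelow (SympGrowth.growthSet (SympGrowth.nonnegCone n) X Y k)) ∧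
    Filter.Tendsto
        (fun k : ℕ => (SympGrowth.growthAt (SympGrowth.nonnegCone n) X Y k : ℝ) / (k : ℝ))
        Filter.atTop (nhds (SympGrowth.relativeGrowth (SympGrowth.nonnegCone n) X Y)) ∧
    SympGrowth.relativeGrowth (SympGrowth.nonnegCone n) X Y =
      SympGrowth.homMaslov Y / SympGrowth.homMaslov X := by
  have hn : NeZero n := by
    refine ⟨?_⟩
    rintro rfl
    -- `Sp(0, ℝ)` is trivial, and so is its cover
    refine hX.2.1 ?_
    induction X using Con.induction_on with | _ P
    exact congrArg _ (Subtype.ext (ContinuousMap.ext fun t => Subtype.ext (Subsingleton.elim _ _)))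
  have hn0 : (0 : ℝ) < n := by exact_mod_cast NeZero.pos n
  have hmul : ∀ f ∈ nonnegCone n, ∀ g ∈ nonnegCone n, f * g ∈ nonnegCone n :=
    fun _ hf _ hg => mul_mem_nonnegCone hf hg
  have hz : fullRotation n ∈ nonnegCone n := rotPath_mem_nonnegCone fun _ => zero_le_one
  have hpos : ∀ f ∈ nonnegCone n, 0 ≤ maslov f := fun _ hf => maslov_nonneg hf
  have hdefect := exists_defect_of_isBetween hn0 hmul commute_fullRotation hpos
    maslov_fullRotation_zpow exists_isBetween_and_abs_maslov_sub_le
  have hlim : ∀ x : SpCover n, Filter.Tendsto (fun k : ℕ => maslov (x ^ k) / (k : ℝ)) Filter.atTop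
      (nhds (homMaslov x)) := by
    intro x
    obtain ⟨L, hL, -⟩ := exists_homogenization hdefect x
    rwa [homMaslov, hL.limUnder_eq]
  have hunb : ∀ R : ℝ, ∃ g : SpCover n, R ≤ maslov g := by
    intro R
    refine ⟨fullRotation n ^ ⌈R / n⌉, ?_⟩
    rw [maslov_fullRotation_zpow, ← div_le_iff₀' hn0]
    exact Int.le_ceil _
  obtain ⟨h1, h2, h3⟩ := relativeGrowth_eq_of_quasimorphism hdefect hpos
    (fun f hf => mem_cone_of_le hn0 hmul one_mem_nonnegCone hz
      exists_isBetween_and_abs_maslov_sub_le hf) hunb hX (hlim X) (hlim Y)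
  have h4 : relativeGrowth (nonnegCone n) X Y = homMaslov Y / homMaslov X := h3.limUnder_eq
  exact ⟨hlim X, hlim Y, h1, h2, h4 ▸ h3, h4⟩
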